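/- **Theorem 4.2.** Let $\mathcal X$ be a Euclidean (finite-dimensional real inner product) space and $N>1$ an integer. Let $\beta>0$ and, for $n=1,\dots,N$, let $f_n:\mathcal X\to\mathbb R$ be convex and differentiable with $\frac1\beta$-Lipschitz continuous gradient, and let $g_n:\mathcal X\to(-\infty,+\infty]$ be proper, convex and lower semicontinuous. Assume that the infimum of $\sum_{n=1}^N(f_n(x)+g_n(x))$ over $x\in\mathcal X$ is attained and that $\bigcap_{n=1}^N \operatorname{ri}(\operatorname{dom} g_n)\neq\emptyset$. Let $(\zeta^k)_{k\ge1}$ be an i.i.d. sequence of random variables with values in $\{1,\dots,N\}$ such that $\mathbb P[\zeta^1=n]>0$ for every $n$. Suppose $0<\gamma<2\beta$ and $0<\lambda\le\frac12$. Given any initial point $(v^0,y^0,x^0)\in\mathcal X^N\times\mathcal X^N\times\mathcal X^N$, let $(v^k,y^k,x^k)$ be generated by the algorithm SMSPDFP$^2$O: at step $k\ge0$ put $$\bar z^{k+1}=\frac1N\sum_{m=1}^N\bigl(x^k_m-\gamma\nabla f_m(x^k_m)-\lambda y^k_m\bigr)+(1-\lambda)\frac1N\sum_{m=1}^N v^k_m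 ,$$ for the block $n=\zeta^{k+1}$ set $$\begin{aligned} v^{k+1}_n&=x^k_n-\gamma\nabla f_n(x^k_n)+(1-\lambda)v^k_n-\lambda y^k_n-\bar z^{k+1},\\ y^{k+1}_n&=\bigl(I-\operatorname{prox}_{\frac\gamma\lambda g_n}\bigr)\bigl(x^k_n-\gamma\nabla f_n(x^k_n)+(1-\lambda)y^k_n-\lambda v^k_n\bigr),\\ x^{k+1}_n&=x^k_n-\gamma\nabla f_n(x^k_n)-\lambda v^{k+1}_n-\lambda y^{k+1}_n, \end{aligned}$$ and for all $n\ne\zeta^{k+1}$ set $v^{k+1}_n=v^k_n$, $y^{k+1}_n=y^k_n$, $x^{k+1}_n=x^k_n$. Here $\operatorname{prox}_{\varphi}(x)=\operatorname{argmin}_{z\in\mathcal X}\ \varphi(z)+\frac12\|x-z\|^2$. Then, almost surely, the averages $\bar x^k=\frac1N\sum_{n=1}^N x^k_n$ converge to a point $x^\ast\in\mathcal X$ (which may depend on the realization) such that $(x^\ast,\dots,x^\ast)$ is a solution of $$\min_{x\in\mathcal X^N}\ \sum_{n=1}^N f_n(x_n)+\sum_{n=1}^N g_n(x_n)+\iota_{\mathcal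 C}(x),\qquad \mathcal C=\{x\in\mathcal X^N: x_1=\dots=x_N\},\tag{4.3}$$ where $\iota_{\mathcal C}$ is $0$ on $\mathcal C$ and $+\infty$ elsewhere. -/

import Mathlib

open Set Filter Topology MeasureTheory ProbabilityTheory
open scoped BigOperators

noncomputable section

namespace SMSPDFP

/-- The effective domain of an extended-real-valued function. -/
def effDom {E : Type*} (φ : E → EReal) : Set E :=
  {x | φ x < ⊤}

/-- The class `Γ₀(E)` of proper lower semicontinuous convex functions `E → (-∞, +∞]`. -/
structure GammaZero {E : Type*} [TopologicalSpace E] [AddCommGroup E] [Module ℝ E]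
    (φ : E → EReal) : Prop where
  ne_bot : ∀ x, φ x ≠ ⊥
  proper : ∃ x, φ x ≠ ⊤
  lsc : LowerSemicontinuous φ
  convex : ∀ (x y : E) (a b : ℝ), 0 < a → 0 < b → a + b = 1 →
    φ (a • x + b • y) ≤ (a : EReal) * φ x + (b : EReal) * φ y

/-- `x` is a global minimizer of `F` (a solution of `min F`). -/
def IsMinimizer {E : Type*} (F : E → EReal) (x : E) : Prop :=
  ∀ z, F x ≤ F z

/-- The proximity operator `prox_φ(x) = argmin_z φ(z) + ½ ‖x - z‖²`. For `φ ∈ Γ₀` the minimizer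
exists and is unique, so that the choice below is the argmin. -/
def prox {E : Type*} [NormedAddCommGroup E] (φ : E → EReal) (x : E) : E :=
  Classical.epsilon fun p =>
    IsMinimizer (fun z => φ z + ((1 / 2 * ‖x - z‖ ^ 2 : ℝ) : EReal)) p

/-- The indicator function `ι_A`: `0` on `A`, `+∞` outside. -/
def indicatorFn {E : Type*} (A : Set E) (x : E) : EReal :=
  open Classical in if x ∈ A then 0 else ⊤

/-- The average `N⁻¹ ∑ₙ xₙ`. -/
def avg {X : Type*} [AddCommGroup X] [Module ℝ X] {N : ℕ} (x : Fin N → X) : X :=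
  (N : ℝ)⁻¹ • ∑ n, x n

/-- The consensus space `C = {x ∈ X^N : x₁ = ⋯ = x_N}`. -/
def consensus (X : Type*) (N : ℕ) : Set (Fin N → X) :=
  {x | ∀ m n, x m = x n}

/-- The objective `x ↦ f(x) + g(x) + h(D x)` of the general composite problem. -/
def compositeObjective {E F : Type*} [AddCommGroup E] [Module ℝ E] [AddCommGroup F] [Module ℝ F]
    (f : E → ℝ) (g : E → EReal) (h : F → EReal) (D : E →ₗ[ℝ] F) (x : E) : EReal :=
  (f x : EReal) + g x + h (D x)

/-- The objective `x ↦ ∑ₙ (fₙ(x) + gₙ(x))` of the minibatch problem on `X`. -/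
def sumObjective {X : Type*} {N : ℕ} (f : Fin N → X → ℝ) (g : Fin N → X → EReal) (x : X) :
    EReal :=
  ∑ n, ((f n x : EReal) + g n x)

/-- The objective of the lifted problem on `X^N`: the composite objective with
`f(x) = ∑ₙ fₙ(xₙ)`, `g(x) = ∑ₙ gₙ(xₙ)`, `h = ι_C` and `D` the identity. -/
def liftedObjective {X : Type*} [AddCommGroup X] [Module ℝ X] {N : ℕ}
    (f : Fin N → X → ℝ) (g : Fin N → X → EReal) : (Fin N → X) → EReal :=
  compositeObjective (fun x => ∑ n, f n (x n)) (fun x => ∑ n, g n (x n))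
    (indicatorFn (consensus X N)) LinearMap.id

/-- The standing assumption on the data of the minibatch problem. -/
structure MinibatchAssumption {X : Type*} [NormedAddCommGroup X] [InnerProductSpace ℝ X]
    [CompleteSpace X] {N : ℕ} (β : ℝ) (f : Fin N → X → ℝ) (g : Fin N → X → EReal) : Prop where
  beta_pos : 0 < β
  f_convex : ∀ n, ConvexOn ℝ univ (f n)
  f_diff : ∀ n, Differentiable ℝ (f n)
  f_lipschitz : ∀ n x y, ‖gradient (f n) x - gradient (f n) y‖ ≤ 1 / β * ‖x - y‖
  g_gammaZero : ∀ n, GammaZero (g n)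
  attained : ∃ x, IsMinimizer (sumObjective f g) x
  ri_dom : (⋂ n, intrinsicInterior ℝ (effDom (g n))).Nonempty

/-- The variables `(v, y, x) ∈ X^N × X^N × X^N` of the algorithm. -/
structure State (X : Type*) (N : ℕ) where
  v : Fin N → X
  y : Fin N → X
  x : Fin N → X

/-- One step of the stochastic minibatch algorithm in which block `n` is updated:
* `zbar = N⁻¹ ∑ₘ (xₘ - γ ∇fₘ(xₘ) - λ yₘ) + (1 - λ) N⁻¹ ∑ₘ vₘ`,
* `vₙ⁺ = xₙ - γ ∇fₙ(xₙ) + (1 - λ) vₙ - λ yₙ - zbar`,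
* `yₙ⁺ = (I - prox_{(γ/λ) gₙ})(xₙ - γ ∇fₙ(xₙ) + (1 - λ) yₙ - λ vₙ)`,
* `xₙ⁺ = xₙ - γ ∇fₙ(xₙ) - λ vₙ⁺ - λ yₙ⁺`,
and all other blocks are left unchanged. -/
def step {X : Type*} [NormedAddCommGroup X] [InnerProductSpace ℝ X] [CompleteSpace X] {N : ℕ}
    (f : Fin N → X → ℝ) (g : Fin N → X → EReal) (γ lam : ℝ) (n : Fin N) (u : State X N) :
    State X N :=
  let s : Fin N → X := fun m => u.x m - γ • gradient (f m) (u.x m)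
  let zbar : X := avg (fun m => s m - lam • u.y m) + (1 - lam) • avg u.v
  let vnew : X := s n + (1 - lam) • u.v n - lam • u.y n - zbar
  let p : X := s n + (1 - lam) • u.y n - lam • u.v n
  let ynew : X := p - prox (fun z => ((γ / lam : ℝ) : EReal) * g n z) p
  let xnew : X := s n - lam • vnew - lam • ynew
  { v := Function.update u.v n vnew
    y := Function.update u.y n ynew
    x := Function.update u.x n xnew }

/-- The iterates `(vᵏ, yᵏ, xᵏ)` of the stochastic minibatch algorithm from the initial point `u₀`,
where `ζ k` is the block updated in the step from iterate `k` to iterate `k + 1`. -/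
def iterates {X : Type*} [NormedAddCommGroup X] [InnerProductSpace ℝ X] [CompleteSpace X] {N : ℕ}
    (f : Fin N → X → ℝ) (g : Fin N → X → EReal) (γ lam : ℝ) (ζ : ℕ → Fin N) (u₀ : State X N) :
    ℕ → State X N
  | 0 => u₀
  | k + 1 => step f g γ lam (ζ k) (iterates f g γ lam ζ u₀ k)

/-- The random block choices are i.i.d. and every block has positive probability. -/
structure BlockSelection {Ω : Type*} [MeasurableSpace Ω] (μ : Measure Ω) {N : ℕ}
    (ζ : ℕ → Ω → Fin N) : Prop where
  measurable : ∀ k, Measurable (ζ k)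
  indep : iIndepFun ζ μ
  identDistrib : ∀ k, IdentDistrib (ζ k) (ζ 0) μ μ
  pos : ∀ n, 0 < μ {ω | ζ 0 ω = n}

end SMSPDFP

end

/-! Let T update all blocks (v_n, y_n, x_n) at once (`fullStep`). Fixed points of T encode
solutions: all x_n equal one point x₀, (λ/γ) y_n is a subgradient of g_n at x₀, and ∑ v_n = 0 says
that gradients and subgradients balance. A fixed point exists because a minimizer admits such
subgradients, by the sum rule under the relative interior condition
(`exists_subgradients_sum_eq_neg`).

In the metric ‖x‖² + λ(‖v‖² + ‖y‖²), T lowers the squared distance to each fixed point by at least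
`residual` (`sum_blockNormSq_fullStep_le`). Weighting blocks by inverse probabilities makes the mean
change under one random block update equal to the unweighted change under T
(`sum_mul_lyapunov_update`). The weighted distance is thus a nonnegative supermartingale: almost
surely it converges and the residual tends to zero.

The residual controls v + y and the difference of the increments of v and y, but not their sum when
λ = 1/2. It also vanishes in the limit after one further update of any block
(`ae_tendsto_zero_step`), and both facts together force a fixed point
(`fullStep_eq_of_residual_eq_zero`). So cluster points are fixed points, and Opial's argument over a
countable dense set of fixed points gives convergence. -/

namespace SMSPDFP

open scoped NNReal Pointwise

/-! ### Convex functions with Lipschitz gradient -/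

section Smooth

/-- Turns a bound along a segment, as supplied by convexity or minimality, into a first-order
condition at its starting point. -/
theorem le_of_hasDerivAt_of_forall_mul_le {φ : ℝ → ℝ} {d a : ℝ} (hφ : HasDerivAt φ d 0)
    (h : ∀ s : ℝ, 0 < s → s < 1 → s * a ≤ φ s - φ 0) : a ≤ d := by
  have ht : Tendsto (fun s : ℝ => s⁻¹ * (φ s - φ 0)) (𝓝[>] 0) (𝓝 d) := by
    have := hφ.tendsto_slope_zero_right
    simpa using this
  refine ge_of_tendsto ht ?_
  filter_upwards [Ioo_mem_nhdsGT (zero_lt_one' ℝ)] with s hs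
  have := h s hs.1 hs.2
  rw [inv_mul_eq_div, le_div_iff₀ hs.1]
  linarith

variable {X : Type*} [NormedAddCommGroup X] [InnerProductSpace ℝ X] [CompleteSpace X]

theorem hasDerivAt_comp_line {f : X → ℝ} (hf : Differentiable ℝ f) (x d : X) (t : ℝ) :
    HasDerivAt (fun s : ℝ => f (x + s • d)) (inner ℝ (gradient f (x + t • d)) d) t := by
  have h1 : HasDerivAt (fun s : ℝ => x + s • d) d t := by
    simpa using ((hasDerivAt_id t).smul_const d).const_add x
  have h2 := (hf (x + t • d)).hasGradientAt.hasFDerivAt.comp_hasDerivAt t h1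
  exact h2.congr_deriv (by simp)

theorem gradient_inequality {f : X → ℝ} (hc : ConvexOn ℝ univ f) (hf : Differentiable ℝ f)
    (x z : X) : f x + inner ℝ (gradient f x) (z - x) ≤ f z := by
  have h1 := (hasDerivAt_comp_line hf x (z - x) 0).neg
  have h2 : -(f z - f x) ≤ -inner ℝ (gradient f (x + (0 : ℝ) • (z - x))) (z - x) := by
    refine le_of_hasDerivAt_of_forall_mul_le h1 fun s hs hs1 => ?_
    have h3 := hc.2 (mem_univ x) (mem_univ z) (sub_nonneg.2 hs1.le) hs.le (by ring)
    have h4 : (1 - s) • x + s • z = x + s • (z - x) := by module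
    rw [h4] at h3
    simp only [smul_eq_mul] at h3
    simp only [Pi.neg_apply, zero_smul, add_zero]
    nlinarith
  simp only [zero_smul, add_zero] at h2
  linarith

/-- The descent lemma: along the ray from `x` through `z`, `f` minus its quadratic model has
nonpositive derivative by Cauchy–Schwarz; compare times 0 and 1. -/
theorem le_quadratic_of_lipschitz_gradient {f : X → ℝ} {L : ℝ} (hf : Differentiable ℝ f)
    (hL : ∀ x y, ‖gradient f x - gradient f y‖ ≤ L * ‖x - y‖) (x z : X) :
    f z ≤ f x + inner ℝ (gradient f x) (z - x) + L / 2 * ‖z - x‖ ^ 2 := by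
  set d := z - x with hd
  have hder : ∀ t : ℝ, HasDerivAt
      (fun s : ℝ => f (x + s • d) - s * inner ℝ (gradient f x) d - s ^ 2 * (L / 2 * ‖d‖ ^ 2))
      (inner ℝ (gradient f (x + t • d)) d - inner ℝ (gradient f x) d - 2 * t * (L / 2 * ‖d‖ ^ 2))
      t := by
    intro t
    have h1 := (hasDerivAt_comp_line hf x d t).sub
      ((hasDerivAt_id t).mul_const (inner ℝ (gradient f x) d))
    have h2 := h1.sub ((hasDerivAt_pow 2 t).mul_const (L / 2 * ‖d‖ ^ 2))
    exact h2.congr_deriv (by simp)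
  have hanti : AntitoneOn
      (fun s : ℝ => f (x + s • d) - s * inner ℝ (gradient f x) d - s ^ 2 * (L / 2 * ‖d‖ ^ 2))
      (Ici 0) := by
    refine antitoneOn_of_deriv_nonpos (convex_Ici 0)
      (fun t _ => (hder t).continuousAt.continuousWithinAt)
      (fun t _ => (hder t).differentiableAt.differentiableWithinAt) fun t ht => ?_
    rw [interior_Ici] at ht
    have ht : 0 < t := ht
    rw [(hder t).deriv, ← inner_sub_left]
    have h1 := real_inner_le_norm (gradient f (x + t • d) - gradient f x) d
    have h2 := hL (x + t • d) x
    rw [add_sub_cancel_left, norm_smul, Real.norm_of_nonneg ht.le] at h2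
    nlinarith [norm_nonneg d, mul_le_mul_of_nonneg_right h2 (norm_nonneg d)]
  have h := hanti (mem_Ici.2 le_rfl) (mem_Ici.2 zero_le_one) zero_le_one
  have hz : x + d = z := by rw [hd]; abel
  simp only [one_smul, hz, zero_smul, add_zero] at h
  linarith

/-- The Baillon–Haddad inequality: the gradient of a convex function is `β`-cocoercive as soon as
it is `1 / β`-Lipschitz. -/
theorem gradient_cocoercive {f : X → ℝ} {β : ℝ} (hβ : 0 < β) (hc : ConvexOn ℝ univ f)
    (hf : Differentiable ℝ f)
    (hL : ∀ x y, ‖gradient f x - gradient f y‖ ≤ 1 / β * ‖x - y‖) (x y : X) :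
    β * ‖gradient f x - gradient f y‖ ^ 2 ≤ inner ℝ (gradient f x - gradient f y) (x - y) := by
  -- The point `x - β • D` minimizes the quadratic upper model at `x` minus the tangent at `y`;
  -- evaluating both bounds there gives the gain. Adding the same inequality with `x` and `y`
  -- exchanged gives cocoercivity.
  have key : ∀ x y : X, f y + inner ℝ (gradient f y) (x - y)
      + β / 2 * ‖gradient f x - gradient f y‖ ^ 2 ≤ f x := by
    intro x y
    set D := gradient f x - gradient f y with hD
    have h1 := gradient_inequality hc hf y (x - β • D)
    have h2 := le_quadratic_of_lipschitz_gradient hf hL x (x - β • D)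
    have e1 : x - β • D - y = (x - y) - β • D := by abel
    have e2 : x - β • D - x = -(β • D) := by abel
    rw [e1, inner_sub_right, inner_smul_right] at h1
    rw [e2, inner_neg_right, inner_smul_right, norm_neg, norm_smul,
      Real.norm_of_nonneg hβ.le] at h2
    have h3 : inner ℝ (gradient f x) D - inner ℝ (gradient f y) D = ‖D‖ ^ 2 := by
      rw [← inner_sub_left, ← hD, real_inner_self_eq_norm_sq]
    have h4 : 1 / β / 2 * (β * ‖D‖) ^ 2 = β / 2 * ‖D‖ ^ 2 := by field_simp
    rw [h4] at h2
    have h5 : β * inner ℝ (gradient f x) D - β * inner ℝ (gradient f y) D = β * ‖D‖ ^ 2 := by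
      rw [← mul_sub, h3]
    linarith
  have h1 := key x y
  have h2 := key y x
  rw [norm_sub_rev, ← neg_sub x y, inner_neg_right] at h2
  rw [inner_sub_left]
  linarith

/-- A forward step contracts distances, with a gain measured by the gradients. -/
theorem norm_sq_gradient_step_le {f : X → ℝ} {β γ : ℝ} (hβ : 0 < β) (hγ : 0 ≤ γ)
    (hc : ConvexOn ℝ univ f) (hf : Differentiable ℝ f)
    (hL : ∀ x y, ‖gradient f x - gradient f y‖ ≤ 1 / β * ‖x - y‖) (x y : X) :
    ‖(x - γ • gradient f x) - (y - γ • gradient f y)‖ ^ 2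
      ≤ ‖x - y‖ ^ 2 - γ * (2 * β - γ) * ‖gradient f x - gradient f y‖ ^ 2 := by
  have h := gradient_cocoercive hβ hc hf hL x y
  have e : (x - γ • gradient f x) - (y - γ • gradient f y)
      = (x - y) - γ • (gradient f x - gradient f y) := by module
  rw [e, norm_sub_sq_real, inner_smul_right, norm_smul, Real.norm_of_nonneg hγ,
    real_inner_comm]
  nlinarith [mul_le_mul_of_nonneg_left h hγ]

end Smooth

/-! ### Subgradients and the proximity operator -/

/-- `w` is a subgradient of `φ` at `x`, where `φ` takes the real value `τ`. -/
def HasSubgradient {E : Type*} [NormedAddCommGroup E] [InnerProductSpace ℝ E] (φ : E → EReal)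
    (τ : ℝ) (w x : E) : Prop :=
  φ x = τ ∧ ∀ (z : E) (t : ℝ), φ z ≤ t → τ + inner ℝ w (z - x) ≤ t

section Prox

variable {E : Type*} [NormedAddCommGroup E] [InnerProductSpace ℝ E]

/-- Convexity through real upper bounds, which keeps later estimates out of `EReal` arithmetic. -/
theorem GammaZero.le_combination {φ : E → EReal} (hφ : GammaZero φ) {x y : E} {s t a b : ℝ}
    (hx : φ x ≤ s) (hy : φ y ≤ t) (ha : 0 < a) (hb : 0 < b) (hab : a + b = 1) :
    φ (a • x + b • y) ≤ ((a * s + b * t : ℝ) : EReal) := by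
  refine (hφ.convex x y a b ha hb hab).trans ?_
  rw [EReal.coe_add, EReal.coe_mul, EReal.coe_mul]
  gcongr

theorem GammaZero.exists_coe {φ : E → EReal} (hφ : GammaZero φ) {x : E} (h : φ x ≠ ⊤) :
    ∃ τ : ℝ, φ x = τ :=
  ⟨(φ x).toReal, (EReal.coe_toReal h (hφ.ne_bot x)).symm⟩

theorem GammaZero.const_mul {φ : E → EReal} (hφ : GammaZero φ) {c : ℝ} (hc : 0 < c) :
    GammaZero fun x => (c : EReal) * φ x where
  ne_bot x := by
    induction h : φ x with
    | bot => exact absurd h (hφ.ne_bot x)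
    | coe r => rw [← EReal.coe_mul]; exact EReal.coe_ne_bot _
    | top => simp [EReal.coe_mul_top_of_pos hc]
  proper := by
    obtain ⟨x, hx⟩ := hφ.proper
    obtain ⟨τ, hτ⟩ := hφ.exists_coe hx
    exact ⟨x, by rw [hτ, ← EReal.coe_mul]; exact EReal.coe_ne_top _⟩
  lsc := by
    have h1 : Continuous fun r : EReal => (c : EReal) * r :=
      continuous_iff_continuousAt.2 fun r =>
        ContinuousAt.comp (f := fun r : EReal => ((c : EReal), r))
        (EReal.continuousAt_mul (by simp [hc.ne']) (by simp [hc.ne']) (by simp) (by simp))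
        (by fun_prop)
    have h2 : Monotone fun r : EReal => (c : EReal) * r := fun a b hab => by
      dsimp only
      gcongr
    exact h1.comp_lowerSemicontinuous hφ.lsc h2
  convex x y a b ha hb hab := by
    have h := mul_le_mul_of_nonneg_left (hφ.convex x y a b ha hb hab)
      (show (0 : EReal) ≤ (c : EReal) by exact_mod_cast hc.le)
    refine h.trans (le_of_eq ?_)
    rw [EReal.left_distrib_of_nonneg_of_ne_top (by exact_mod_cast hc.le) (EReal.coe_ne_top _)]
    rw [mul_left_comm, mul_left_comm (c : EReal) (b : EReal)]

theorem HasSubgradient.const_mul {φ : E → EReal} {τ c : ℝ} {w x : E} (h : HasSubgradient φ τ w x)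
    (hc : 0 < c) : HasSubgradient (fun z => (c : EReal) * φ z) (c * τ) (c • w) x := by
  refine ⟨by simp [h.1], fun z t hz => ?_⟩
  have h1 : φ z ≤ ((c⁻¹ * t : ℝ) : EReal) := by
    have h2 := mul_le_mul_of_nonneg_left hz
      (show (0 : EReal) ≤ ((c⁻¹ : ℝ) : EReal) by exact_mod_cast (inv_pos.2 hc).le)
    rwa [← mul_assoc, ← EReal.coe_mul, inv_mul_cancel₀ hc.ne', EReal.coe_one, one_mul,
      ← EReal.coe_mul] at h2
  have h3 := h.2 z _ h1
  rw [real_inner_smul_left, ← mul_add]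
  rwa [inv_mul_eq_div, le_div_iff₀ hc, mul_comm] at h3

theorem HasSubgradient.inner_nonneg {φ : E → EReal} {τ₁ τ₂ : ℝ} {w₁ w₂ x₁ x₂ : E}
    (h₁ : HasSubgradient φ τ₁ w₁ x₁) (h₂ : HasSubgradient φ τ₂ w₂ x₂) :
    0 ≤ inner ℝ (w₁ - w₂) (x₁ - x₂) := by
  have a := h₁.2 x₂ τ₂ h₂.1.le
  have b := h₂.2 x₁ τ₁ h₁.1.le
  rw [← neg_sub x₁ x₂, inner_neg_right] at a
  rw [inner_sub_left]
  linarith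

theorem isMinimizer_prox_objective_iff {φ : E → EReal} (hφ : GammaZero φ) (x p : E) :
    IsMinimizer (fun z => φ z + ((1 / 2 * ‖x - z‖ ^ 2 : ℝ) : EReal)) p
      ↔ ∃ τ : ℝ, HasSubgradient φ τ (x - p) p := by
  constructor
  · intro h
    obtain ⟨z₀, hz₀⟩ := hφ.proper
    obtain ⟨τ₀, hτ₀⟩ := hφ.exists_coe hz₀
    have hp : φ p ≠ ⊤ := by
      intro hp
      have := h z₀
      simp only [hp, hτ₀] at this
      rw [EReal.top_add_coe, ← EReal.coe_add] at this
      exact EReal.coe_ne_top _ (top_le_iff.1 this)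
    obtain ⟨τ, hτ⟩ := hφ.exists_coe hp
    refine ⟨τ, hτ, fun z t hz => ?_⟩
    -- This function bounds the increase of the prox objective from `p` to `p + s • (z - p)`.
    -- Minimality makes it nonnegative, and its quadratic part does not contribute at 0.
    have hder : HasDerivAt (fun s : ℝ => s * (t - τ) - s * inner ℝ (x - p) (z - p)
        + s ^ 2 * (1 / 2 * ‖z - p‖ ^ 2)) ((t - τ) - inner ℝ (x - p) (z - p)) 0 := by
      have := (((hasDerivAt_id (0 : ℝ)).mul_const (t - τ)).sub
        ((hasDerivAt_id (0 : ℝ)).mul_const (inner ℝ (x - p) (z - p)))).add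
        ((hasDerivAt_pow 2 (0 : ℝ)).mul_const (1 / 2 * ‖z - p‖ ^ 2))
      exact this.congr_deriv (by simp)
    have h0 := le_of_hasDerivAt_of_forall_mul_le (a := 0) hder fun s hs hs1 => ?_
    · linarith
    have h1 := hφ.le_combination hτ.le hz (sub_pos.2 hs1) hs (by ring)
    have e : (1 - s) • p + s • z = p + s • (z - p) := by module
    rw [e] at h1
    have h2 := (h (p + s • (z - p))).trans (add_le_add_left h1 _)
    simp only [hτ] at h2
    have h3 : τ + 1 / 2 * ‖x - p‖ ^ 2 ≤
        (1 - s) * τ + s * t + 1 / 2 * ‖x - (p + s • (z - p))‖ ^ 2 := by exact_mod_cast h2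
    rw [← sub_sub, norm_sub_sq_real (x - p), inner_smul_right, norm_smul,
      Real.norm_of_nonneg hs.le] at h3
    nlinarith
  · rintro ⟨τ, hτ, h⟩ z
    simp only [hτ]
    by_cases hz : φ z = ⊤
    · rw [hz, EReal.top_add_coe]; exact le_top
    obtain ⟨t, ht⟩ := hφ.exists_coe hz
    rw [ht]
    have h1 := h z t ht.le
    have h2 : ‖x - z‖ ^ 2 = ‖x - p‖ ^ 2 - 2 * inner ℝ (x - p) (z - p) + ‖z - p‖ ^ 2 := by
      rw [← norm_sub_sq_real]; congr 2; abel
    have h3 : τ + 1 / 2 * ‖x - p‖ ^ 2 ≤ t + 1 / 2 * ‖x - z‖ ^ 2 := by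
      nlinarith [sq_nonneg ‖z - p‖]
    exact_mod_cast h3

/-- The given subgradient is an affine minorant, so the objective is no smaller than at `x₀` outside
a ball; compactness and lower semicontinuity settle the ball. -/
theorem exists_isMinimizer_prox_objective [FiniteDimensional ℝ E] {φ : E → EReal}
    (hφ : GammaZero φ) {τ : ℝ} {w x₀ : E} (h : HasSubgradient φ τ w x₀) (x : E) :
    ∃ p, IsMinimizer (fun z => φ z + ((1 / 2 * ‖x - z‖ ^ 2 : ℝ) : EReal)) p := by
  have hlsc : LowerSemicontinuous fun z => φ z + ((1 / 2 * ‖x - z‖ ^ 2 : ℝ) : EReal) := by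
    refine hφ.lsc.add' (Continuous.lowerSemicontinuous ?_) fun z => ?_
    · exact continuous_coe_real_ereal.comp (by fun_prop)
    · exact EReal.continuousAt_add (Or.inr (EReal.coe_ne_bot _)) (Or.inr (EReal.coe_ne_top _))
  -- With r = ‖z - x₀‖, the gain r²/2 beats the linear loss (‖w‖ + ‖x - x₀‖) r beyond this radius.
  set R : ℝ := 2 * ‖w‖ + 2 * ‖x - x₀‖ + 1 with hR
  have hRpos : 0 ≤ R := by positivity
  obtain ⟨p, -, hmin⟩ := (hlsc.lowerSemicontinuousOn (Metric.closedBall x₀ R)).exists_isMinOn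
    ⟨x₀, Metric.mem_closedBall_self hRpos⟩ (isCompact_closedBall x₀ R)
  refine ⟨p, fun z => ?_⟩
  by_cases hz : z ∈ Metric.closedBall x₀ R
  · exact hmin hz
  refine (hmin (Metric.mem_closedBall_self hRpos)).trans ?_
  simp only [h.1]
  by_cases hzt : φ z = ⊤
  · rw [hzt, EReal.top_add_coe]; exact le_top
  obtain ⟨t, ht⟩ := hφ.exists_coe hzt
  rw [ht]
  have h1 := h.2 z t ht.le
  rw [Metric.mem_closedBall, not_le, dist_eq_norm] at hz
  have h2 : ‖x - z‖ ^ 2 = ‖x - x₀‖ ^ 2 - 2 * inner ℝ (x - x₀) (z - x₀) + ‖z - x₀‖ ^ 2 := by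
    rw [← norm_sub_sq_real]; congr 2; abel
  have h3 := neg_le_of_abs_le (abs_real_inner_le_norm w (z - x₀))
  have h4 := real_inner_le_norm (x - x₀) (z - x₀)
  have h5 : τ + 1 / 2 * ‖x - x₀‖ ^ 2 ≤ t + 1 / 2 * ‖x - z‖ ^ 2 := by
    have h6 : 0 ≤ ‖z - x₀‖ * (‖z - x₀‖ - (2 * ‖w‖ + 2 * ‖x - x₀‖)) :=
      mul_nonneg (norm_nonneg _) (by linarith)
    nlinarith
  exact_mod_cast h5

variable [FiniteDimensional ℝ E]

theorem hasSubgradient_prox {φ : E → EReal} (hφ : GammaZero φ) {τ : ℝ} {w x₀ : E}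
    (h : HasSubgradient φ τ w x₀) (x : E) :
    ∃ σ : ℝ, HasSubgradient φ σ (x - prox φ x) (prox φ x) :=
  (isMinimizer_prox_objective_iff hφ x _).1
    (Classical.epsilon_spec (exists_isMinimizer_prox_objective hφ h x))

theorem prox_eq_of_hasSubgradient {φ : E → EReal} (hφ : GammaZero φ) {τ : ℝ} {x p : E}
    (h : HasSubgradient φ τ (x - p) p) : prox φ x = p := by
  obtain ⟨σ, hσ⟩ := hasSubgradient_prox hφ h x
  have h1 := hσ.inner_nonneg h
  have e : x - prox φ x - (x - p) = -(prox φ x - p) := by abel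
  rw [e, inner_neg_left, real_inner_self_eq_norm_sq] at h1
  have h2 : ‖prox φ x - p‖ = 0 := by nlinarith [norm_nonneg (prox φ x - p)]
  exact sub_eq_zero.1 (norm_eq_zero.1 h2)

/-- Monotonicity of the subdifferential, that is, firm nonexpansiveness of `prox φ`; the descent
estimate needs nothing else about it. -/
theorem inner_sub_prox_nonneg {φ : E → EReal} (hφ : GammaZero φ) {τ : ℝ} {w x₀ : E}
    (h : HasSubgradient φ τ w x₀) (x y : E) :
    0 ≤ inner ℝ ((x - prox φ x) - (y - prox φ y)) (prox φ x - prox φ y) := by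
  obtain ⟨σ, hσ⟩ := hasSubgradient_prox hφ h x
  obtain ⟨ρ, hρ⟩ := hasSubgradient_prox hφ h y
  exact hσ.inner_nonneg hρ

theorem continuous_prox {φ : E → EReal} (hφ : GammaZero φ) {τ : ℝ} {w x₀ : E}
    (h : HasSubgradient φ τ w x₀) : Continuous (prox φ) := by
  refine (LipschitzWith.of_dist_le_mul (K := 1) fun x y => ?_).continuous
  have h1 := inner_sub_prox_nonneg hφ h x y
  have e : (x - prox φ x) - (y - prox φ y) = (x - y) - (prox φ x - prox φ y) := by abel
  rw [e, inner_sub_left, real_inner_self_eq_norm_sq] at h1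
  have h2 := real_inner_le_norm (x - y) (prox φ x - prox φ y)
  rw [dist_eq_norm, dist_eq_norm, NNReal.coe_one, one_mul]
  by_contra! h3
  nlinarith [norm_nonneg (x - y)]

end Prox

/-! ### The subdifferential sum rule under the relative interior condition -/

section SumRule

theorem eventually_add_smul_mem_of_mem_intrinsicInterior {E : Type*} [NormedAddCommGroup E]
    [NormedSpace ℝ E] {s : Set E} {x v : E} (hx : x ∈ intrinsicInterior ℝ s)
    (hv : v ∈ vectorSpan ℝ s) : ∀ᶠ t in 𝓝 (0 : ℝ), x + t • v ∈ s := by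
  obtain ⟨y, hy, rfl⟩ := mem_intrinsicInterior.1 hx
  have hmem : ∀ t : ℝ, (y : E) + t • v ∈ affineSpan ℝ s := fun t => by
    have h := AffineSubspace.vadd_mem_of_mem_direction (s := affineSpan ℝ s) (v := t • v)
      (by rw [direction_affineSpan]; exact Submodule.smul_mem _ t hv) y.2
    rwa [vadd_eq_add, add_comm] at h
  have hc : Continuous fun t : ℝ => (⟨(y : E) + t • v, hmem t⟩ : affineSpan ℝ s) := by fun_prop
  have h0 : (⟨(y : E) + (0 : ℝ) • v, hmem 0⟩ : affineSpan ℝ s) = y := by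
    ext; simp
  have h1 := hc.continuousAt (x := 0) |>.preimage_mem_nhds
    (t := interior ((↑) ⁻¹' s)) (by rw [h0]; exact isOpen_interior.mem_nhds hy)
  filter_upwards [h1] with t ht using interior_subset (s := ((↑) ⁻¹' s : Set (affineSpan ℝ s))) ht

variable {X : Type*} [NormedAddCommGroup X] [InnerProductSpace ℝ X] {N : ℕ}

/-- The epigraph of the perturbation function `d ↦ inf_z ∑ₙ gₙ(x₀ + z + dₙ) + ⟪c, z⟫ - ∑ₙ τₙ`. -/
def perturbationEpigraph (g : Fin N → X → EReal) (c x₀ : X) (τ : Fin N → ℝ) :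
    Set ((Fin N → X) × ℝ) :=
  {p | ∃ (z : X) (t : Fin N → ℝ), (∀ n, g n (x₀ + z + p.1 n) ≤ t n) ∧
    ∑ n, t n - ∑ n, τ n + inner ℝ c z ≤ p.2}

theorem convex_perturbationEpigraph {g : Fin N → X → EReal} (hg : ∀ n, GammaZero (g n))
    (c x₀ : X) (τ : Fin N → ℝ) : Convex ℝ (perturbationEpigraph g c x₀ τ) := by
  rw [convex_iff_forall_pos]
  rintro ⟨d, r⟩ ⟨z, t, ht, hr⟩ ⟨d', r'⟩ ⟨z', t', ht', hr'⟩ a b ha hb hab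
  refine ⟨a • z + b • z', fun n => a * t n + b * t' n, fun n => ?_, ?_⟩
  · have h := (hg n).le_combination (ht n) (ht' n) ha hb hab
    convert h using 2
    have e : x₀ = a • x₀ + b • x₀ := by rw [← add_smul, hab, one_smul]
    simp only [Prod.smul_mk, Prod.mk_add_mk, Pi.add_apply, Pi.smul_apply]
    nth_rewrite 1 [e]
    module
  · simp only [Prod.smul_mk, Prod.mk_add_mk, smul_eq_mul, Finset.sum_add_distrib,
      ← Finset.mul_sum, inner_add_right, inner_smul_right] at hr hr' ⊢
    have e : ∑ n, τ n = a * ∑ n, τ n + b * ∑ n, τ n := by rw [← add_mul, hab, one_mul]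
    nlinarith [mul_le_mul_of_nonneg_left hr ha.le, mul_le_mul_of_nonneg_left hr' hb.le]

/-- The space of perturbations `d` such that `d + (z, …, z)` is, for some `z`, parallel to the
product of the domains. -/
def perturbationSpace (g : Fin N → X → EReal) : Submodule ℝ (Fin N → X) where
  carrier := {d | ∃ z, ∀ n, d n + z ∈ vectorSpan ℝ (effDom (g n))}
  zero_mem' := ⟨0, fun n => by simp⟩
  add_mem' := by
    rintro d d' ⟨z, hz⟩ ⟨z', hz'⟩
    refine ⟨z + z', fun n => ?_⟩
    have h := add_mem (hz n) (hz' n)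
    rwa [add_add_add_comm] at h
  smul_mem' := by
    rintro a d ⟨z, hz⟩
    refine ⟨a • z, fun n => ?_⟩
    have h := Submodule.smul_mem _ a (hz n)
    rwa [smul_add] at h

/-- M. Riesz extension on the cone generated by the epigraph: the functional (d, r) ↦ r on Y' × ℝ,
with Y' a complement of the perturbation space, extends to one nonnegative on the cone. -/
theorem exists_linear_minorant_perturbation {g : Fin N → X → EReal} (hg : ∀ n, GammaZero (g n))
    (hri : (⋂ n, intrinsicInterior ℝ (effDom (g n))).Nonempty) {c x₀ : X} {τ : Fin N → ℝ}
    (hτ : ∀ n, g n x₀ = τ n)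
    (hmin : ∀ (z : X) (t : Fin N → ℝ), (∀ n, g n z ≤ t n) →
      ∑ n, τ n ≤ ∑ n, t n + inner ℝ c (z - x₀)) :
    ∃ L : (Fin N → X) →ₗ[ℝ] ℝ, ∀ d r, (d, r) ∈ perturbationEpigraph g c x₀ τ → 0 ≤ L d + r := by
  obtain ⟨x', hx'⟩ := hri
  have hx' : ∀ n, x' ∈ intrinsicInterior ℝ (effDom (g n)) := fun n => mem_iInter.1 hx' n
  set K := perturbationEpigraph g c x₀ τ with hK
  have hKc : Convex ℝ K := convex_perturbationEpigraph hg c x₀ τ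
  have hK0 : (0 : (Fin N → X) × ℝ) ∈ K := ⟨0, τ, fun n => by simp [hτ n], by simp⟩
  have hpt : (ConvexCone.hull ℝ K).Pointed := ConvexCone.subset_hull hK0
  obtain ⟨Y', hY'⟩ := Submodule.exists_isCompl (perturbationSpace g)
  obtain ⟨G, hG, hGK⟩ : ∃ G : (Fin N → X) × ℝ →ₗ[ℝ] ℝ,
      (∀ x : ((LinearMap.snd ℝ (Fin N → X) ℝ).toPMap (Y'.prod ⊤)).domain,
        G x = (LinearMap.snd ℝ (Fin N → X) ℝ).toPMap (Y'.prod ⊤) x) ∧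
      ∀ x ∈ (ConvexCone.hull ℝ K).toPointedCone hpt, 0 ≤ G x := by
    refine riesz_extension _ _ ?_ ?_
    -- Nonnegativity: a cone element has d in the perturbation space, so d = 0 when also d ∈ Y';
    -- then r ≥ 0 is the minimality of `x₀`.
    · rintro ⟨⟨d, r⟩, hd, _⟩ hx
      change 0 ≤ r
      have hd : d ∈ Y' := hd
      obtain ⟨ρ, hρ, ⟨d', r'⟩, ⟨z, t, ht, hr⟩, he⟩ := (ConvexCone.mem_hull_of_convex hKc).1 hx
      have he1 : ρ • d' = d := congrArg Prod.fst he
      have he2 : ρ * r' = r := congrArg Prod.snd he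
      have hdY : d ∈ perturbationSpace g := by
        rw [← he1]
        refine Submodule.smul_mem _ _ ⟨x₀ + z - x', fun n => ?_⟩
        have h := vsub_mem_vectorSpan ℝ (s := effDom (g n)) (p₁ := x₀ + z + d' n) (p₂ := x')
          (lt_of_le_of_lt (ht n) (EReal.coe_lt_top _)) (intrinsicInterior_subset (hx' n))
        rw [vsub_eq_sub] at h
        convert h using 1
        abel
      have hd0 : d = 0 := Submodule.disjoint_def.1 hY'.disjoint d hdY hd
      have hd0' : d' = 0 := (smul_eq_zero.1 (he1.trans hd0)).resolve_left hρ.ne'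
      subst hd0'
      simp only [Pi.zero_apply, add_zero] at ht
      have h := hmin _ t ht
      rw [add_sub_cancel_left] at h
      rw [← he2]
      have hr : ∑ n, t n - ∑ n, τ n + inner ℝ c z ≤ r' := hr
      exact mul_nonneg hρ.le (by linarith)
    -- Absorption: after removing the Y' component, a small multiple of d keeps all shifted points
    -- in the domains, since `x'` is relatively interior to each.
    · rintro ⟨d, r⟩
      obtain ⟨d₁, ⟨z, hz⟩, d₂, hd₂, rfl⟩ := Submodule.mem_sup.1
        (show d ∈ perturbationSpace g ⊔ Y' by rw [hY'.sup_eq_top]; trivial)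
      have hev : ∀ᶠ s in 𝓝[>] (0 : ℝ), ∀ n, x' + s • (d₁ n + z) ∈ effDom (g n) :=
        nhdsWithin_le_nhds (eventually_all.2 fun n =>
          eventually_add_smul_mem_of_mem_intrinsicInterior (hx' n) (hz n))
      obtain ⟨s, hs, hs0⟩ := (hev.and self_mem_nhdsWithin).exists
      have hs0 : 0 < s := hs0
      choose t ht using fun n => (hg n).exists_coe (hs n).ne
      -- Chosen so that x₀ + z' + s d₁ = x' + s (d₁ + z), a point of the n-th domain.
      set z' := x' - x₀ + s • z with hz'
      refine ⟨⟨(-d₂, s⁻¹ * (∑ n, t n - ∑ n, τ n + inner ℝ c z') - r), ⟨Y'.neg_mem hd₂, trivial⟩⟩, ?_⟩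
      refine (ConvexCone.mem_hull_of_convex hKc).2 ⟨s⁻¹, inv_pos.2 hs0, ?_⟩
      refine ⟨(s • d₁, ∑ n, t n - ∑ n, τ n + inner ℝ c z'), ⟨z', t, fun n => ?_, le_rfl⟩, ?_⟩
      · rw [← ht n, hz']
        refine le_of_eq (congrArg _ ?_)
        simp only [Pi.smul_apply]
        module
      · ext1
        · simp [smul_smul, inv_mul_cancel₀ hs0.ne']
        · simp
  refine ⟨G.comp (LinearMap.inl ℝ _ _), fun d r hdr => ?_⟩
  have h1 := hGK (d, r) (ConvexCone.subset_hull hdr)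
  have h2 := hG ⟨(0, r), ⟨Y'.zero_mem, trivial⟩⟩
  have h3 : ((d, r) : (Fin N → X) × ℝ) = (d, 0) + (0, r) := by simp
  rw [h3, map_add] at h1
  change G (0, r) = r at h2
  rw [h2] at h1
  exact h1

/-- The subdifferential sum rule at a minimizer of `∑ₙ gₙ + ⟪c, ·⟫`. -/
theorem exists_subgradients_sum_eq_neg [FiniteDimensional ℝ X] {g : Fin N → X → EReal}
    (hg : ∀ n, GammaZero (g n))
    (hri : (⋂ n, intrinsicInterior ℝ (effDom (g n))).Nonempty) {c x₀ : X} {τ : Fin N → ℝ}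
    (hτ : ∀ n, g n x₀ = τ n)
    (hmin : ∀ (z : X) (t : Fin N → ℝ), (∀ n, g n z ≤ t n) →
      ∑ n, τ n ≤ ∑ n, t n + inner ℝ c (z - x₀)) :
    ∃ ℓ : Fin N → X, (∀ n, HasSubgradient (g n) (τ n) (ℓ n) x₀) ∧ ∑ n, ℓ n = -c := by
  classical
  have := FiniteDimensional.complete ℝ X
  obtain ⟨L, hL⟩ := exists_linear_minorant_perturbation hg hri hτ hmin
  set ℓ : Fin N → X := fun n => -(InnerProductSpace.toDual ℝ X).symm
    (LinearMap.toContinuousLinearMap (L.comp (LinearMap.single ℝ (fun _ => X) n))) with hℓ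
  have hLℓ : ∀ n x, L (Pi.single n x) = -inner ℝ (ℓ n) x := fun n x => by
    simp [hℓ, InnerProductSpace.toDual_symm_apply]
  have hLsum : ∀ d : Fin N → X, L d = -∑ n, inner ℝ (ℓ n) (d n) := fun d => by
    conv_lhs => rw [← Finset.univ_sum_single d]
    rw [map_sum, ← Finset.sum_neg_distrib]
    exact Finset.sum_congr rfl fun n _ => hLℓ n _
  refine ⟨ℓ, fun n => ⟨hτ n, fun y t hy => ?_⟩, ?_⟩
  -- Perturbing a single block gives the subgradient inequality for that block.
  · have h := hL (Pi.single n (y - x₀)) (t - τ n)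
      ⟨0, Function.update τ n t, fun m => ?_, ?_⟩
    · rw [hLℓ] at h
      linarith
    · by_cases hm : m = n
      · subst hm
        simpa using hy
      · simp [hm, hτ m]
    · rw [Finset.sum_update_of_mem (Finset.mem_univ n), ← Finset.add_sum_erase _ τ (Finset.mem_univ n),
        ← Finset.sdiff_singleton_eq_erase, inner_zero_right]
      linarith
  -- Perturbing every block by -z is undone by the shift z, at cost ⟪c, z⟫ alone; as z is arbitrary,
  -- the linear form vanishes.
  · have key : ∀ z : X, 0 ≤ inner ℝ (∑ n, ℓ n + c) z := fun z => by
      have h := hL (fun _ => -z) (inner ℝ c z) ⟨z, τ, fun m => by simp [hτ m], by simp⟩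
      rw [hLsum] at h
      simp only [inner_neg_right, Finset.sum_neg_distrib, neg_neg] at h
      rwa [inner_add_left, sum_inner]
    have h := key (-(∑ n, ℓ n + c))
    rw [inner_neg_right, real_inner_self_eq_norm_sq] at h
    have h0 : ‖∑ n, ℓ n + c‖ = 0 := by nlinarith [norm_nonneg (∑ n, ℓ n + c)]
    exact eq_neg_of_add_eq_zero_left (norm_eq_zero.1 h0)

end SumRule

/-! ### Optimality conditions for the original and lifted problems -/

section Objective

theorem coe_sum_ereal {ι : Type*} (s : Finset ι) (t : ι → ℝ) :
    ((∑ i ∈ s, t i : ℝ) : EReal) = ∑ i ∈ s, (t i : EReal) :=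
  map_sum (⟨⟨((↑) : ℝ → EReal), EReal.coe_zero⟩, EReal.coe_add⟩ : ℝ →+ EReal) t s

theorem sum_ereal_ne_bot {ι : Type*} {s : Finset ι} {t : ι → EReal} (h : ∀ i, t i ≠ ⊥) :
    ∑ i ∈ s, t i ≠ ⊥ :=
  Finset.sum_induction t (· ≠ ⊥) (fun _ _ ha hb => EReal.add_ne_bot_iff.2 ⟨ha, hb⟩) (by simp)
    fun i _ => h i

theorem sum_ereal_eq_top {ι : Type*} [DecidableEq ι] {s : Finset ι} {t : ι → EReal}
    (h : ∀ i, t i ≠ ⊥) {i : ι} (hi : i ∈ s) (hti : t i = ⊤) : ∑ i ∈ s, t i = ⊤ := by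
  rw [← Finset.add_sum_erase _ _ hi, hti, EReal.top_add_of_ne_bot (sum_ereal_ne_bot h)]

variable {X : Type*} [NormedAddCommGroup X] [InnerProductSpace ℝ X] [CompleteSpace X] {N : ℕ}
  {f : Fin N → X → ℝ} {g : Fin N → X → EReal} {β : ℝ}

/-- A primal-dual certificate: a common point `x₀` and subgradients of the nonsmooth terms that
balance the gradients of the smooth terms. -/
theorem MinibatchAssumption.exists_certificate [FiniteDimensional ℝ X]
    (h : MinibatchAssumption β f g) :
    ∃ (x₀ : X) (τ : Fin N → ℝ) (ℓ : Fin N → X), (∀ n, HasSubgradient (g n) (τ n) (ℓ n) x₀) ∧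
      ∑ n, (gradient (f n) x₀ + ℓ n) = 0 := by
  obtain ⟨x₀, hx₀⟩ := h.attained
  have hfin : ∀ n, g n x₀ ≠ ⊤ := by
    intro n hn
    obtain ⟨x', hx'⟩ := h.ri_dom
    choose σ hσ using fun n => (h.g_gammaZero n).exists_coe
      (intrinsicInterior_subset (mem_iInter.1 hx' n)).ne
    have h1 := hx₀ x'
    have h2 : sumObjective f g x₀ = ⊤ := by
      refine sum_ereal_eq_top (fun m => ?_) (Finset.mem_univ n) ?_
      · exact EReal.add_ne_bot_iff.2 ⟨EReal.coe_ne_bot _, (h.g_gammaZero m).ne_bot _⟩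
      · rw [hn, EReal.coe_add_top]
    rw [h2, sumObjective] at h1
    simp only [hσ, ← EReal.coe_add] at h1
    rw [← coe_sum_ereal] at h1
    exact EReal.coe_ne_top _ (top_le_iff.1 h1)
  choose τ hτ using fun n => (h.g_gammaZero n).exists_coe (hfin n)
  have hval : ∀ (z : X) (t : Fin N → ℝ), (∀ n, g n z ≤ t n) →
      ∑ n, f n x₀ + ∑ n, τ n ≤ ∑ n, f n z + ∑ n, t n := by
    intro z t ht
    have h1 := hx₀ z
    have h2 : sumObjective f g z ≤ ((∑ n, (f n z + t n) : ℝ) : EReal) := by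
      rw [coe_sum_ereal]
      refine Finset.sum_le_sum fun n _ => ?_
      rw [EReal.coe_add]
      gcongr
      exact ht n
    have h3 : sumObjective f g x₀ = ((∑ n, (f n x₀ + τ n) : ℝ) : EReal) := by
      rw [coe_sum_ereal]
      refine Finset.sum_congr rfl fun n _ => ?_
      rw [EReal.coe_add, hτ n]
    rw [h3] at h1
    have h4 := EReal.coe_le_coe_iff.1 (h1.trans h2)
    rwa [Finset.sum_add_distrib, Finset.sum_add_distrib] at h4
  -- The smooth part may be replaced by its linearization: move from `x₀` towards `z`, use convexity
  -- of the `g n`, and differentiate at 0.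
  suffices hmin : ∀ (z : X) (t : Fin N → ℝ), (∀ n, g n z ≤ t n) →
      ∑ n, τ n ≤ ∑ n, t n + inner ℝ (∑ n, gradient (f n) x₀) (z - x₀) by
    obtain ⟨ℓ, hℓ, hsum⟩ := exists_subgradients_sum_eq_neg h.g_gammaZero h.ri_dom hτ hmin
    exact ⟨x₀, τ, ℓ, hℓ, by rw [Finset.sum_add_distrib, hsum, add_neg_cancel]⟩
  intro z t ht
  have hder : HasDerivAt (fun s : ℝ => ∑ n, f n (x₀ + s • (z - x₀)))
      (inner ℝ (∑ n, gradient (f n) x₀) (z - x₀)) 0 := by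
    have := HasDerivAt.fun_sum (u := Finset.univ)
      fun n _ => hasDerivAt_comp_line (h.f_diff n) x₀ (z - x₀) 0
    exact this.congr_deriv (by simp [sum_inner])
  have h1 := le_of_hasDerivAt_of_forall_mul_le (a := ∑ n, τ n - ∑ n, t n) hder fun s hs hs1 => ?_
  · linarith
  have h2 := hval ((1 - s) • x₀ + s • z) (fun n => (1 - s) * τ n + s * t n) fun n =>
    (h.g_gammaZero n).le_combination (hτ n).le (ht n) (sub_pos.2 hs1) hs (by ring)
  have e : (1 - s) • x₀ + s • z = x₀ + s • (z - x₀) := by module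
  rw [e, Finset.sum_add_distrib, ← Finset.mul_sum, ← Finset.mul_sum] at h2
  simp only [zero_smul, add_zero]
  linarith

/-- Sum the gradient and subgradient inequalities: on the consensus space the linear terms share one
direction, so they add up to zero. -/
theorem MinibatchAssumption.isMinimizer_liftedObjective (h : MinibatchAssumption β f g) {x₀ : X}
    {τ : Fin N → ℝ} {ℓ : Fin N → X} (hℓ : ∀ n, HasSubgradient (g n) (τ n) (ℓ n) x₀)
    (hsum : ∑ n, (gradient (f n) x₀ + ℓ n) = 0) :
    IsMinimizer (liftedObjective f g) fun _ => x₀ := by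
  classical
  intro z
  have hne : ∀ n, g n (z n) ≠ ⊥ := fun n => (h.g_gammaZero n).ne_bot _
  have hbot : ((∑ n, f n (z n) : ℝ) : EReal) + ∑ n, g n (z n) ≠ ⊥ :=
    EReal.add_ne_bot_iff.2 ⟨EReal.coe_ne_bot _, sum_ereal_ne_bot hne⟩
  by_cases hz : z ∈ consensus X N
  swap
  · have h1 : liftedObjective f g z = ⊤ := by
      simp only [liftedObjective, compositeObjective, indicatorFn, LinearMap.id_apply, hz,
        if_false]
      exact EReal.add_top_of_ne_bot hbot
    rw [h1]
    exact le_top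
  by_cases htop : ∃ n, g n (z n) = ⊤
  · obtain ⟨n, hn⟩ := htop
    have h1 : liftedObjective f g z = ⊤ := by
      simp only [liftedObjective, compositeObjective, indicatorFn, LinearMap.id_apply, hz,
        if_true, add_zero]
      rw [sum_ereal_eq_top hne (Finset.mem_univ n) hn, EReal.coe_add_top]
    rw [h1]
    exact le_top
  push Not at htop
  choose t ht using fun n => (h.g_gammaZero n).exists_coe (htop n)
  have hx : (fun _ => x₀ : Fin N → X) ∈ consensus X N := fun _ _ => rfl
  simp only [liftedObjective, compositeObjective, indicatorFn, LinearMap.id_apply, hz, hx,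
    if_true, add_zero, ht, (hℓ _).1]
  rw [← coe_sum_ereal, ← coe_sum_ereal, ← EReal.coe_add, ← EReal.coe_add, EReal.coe_le_coe_iff]
  have h1 : ∑ n, (f n x₀ + τ n + inner ℝ (gradient (f n) x₀ + ℓ n) (z n - x₀))
      ≤ ∑ n, (f n (z n) + t n) := by
    refine Finset.sum_le_sum fun n _ => ?_
    have h2 := gradient_inequality (h.f_convex n) (h.f_diff n) x₀ (z n)
    have h3 := (hℓ n).2 (z n) (t n) (ht n).le
    rw [inner_add_left]
    linarith
  have h4 : ∑ n, inner ℝ (gradient (f n) x₀ + ℓ n) (z n - x₀) = 0 := by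
    rcases Nat.eq_zero_or_pos N with hN | hN
    · subst hN; simp
    · have h5 : ∀ n, z n = z ⟨0, hN⟩ := fun n => hz _ _
      simp_rw [h5]
      rw [← sum_inner, hsum, inner_zero_left]
  rw [Finset.sum_add_distrib, h4, add_zero] at h1
  rwa [← Finset.sum_add_distrib, ← Finset.sum_add_distrib]

end Objective

/-! ### Random block iterations as supermartingales -/

section BlockIterates

variable {U : Type*} {N : ℕ}

/-- The orbit of `u₀` under the maps `S n` taken in the order prescribed by `ζ`. -/
def blockIterates (S : Fin N → U → U) (ζ : ℕ → Fin N) (u₀ : U) : ℕ → U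
  | 0 => u₀
  | k + 1 => S (ζ k) (blockIterates S ζ u₀ k)

variable {Ω : Type*}

/-- Splits by the selected block. Each iterate takes finitely many values, so by induction over all
`h` at once any real function of it is measurable and integrable, with no structure on `U`. -/
theorem comp_blockIterates_succ (ζ : ℕ → Ω → Fin N) (S : Fin N → U → U) (u₀ : U) (h : U → ℝ)
    (k : ℕ) : (fun ω => h (blockIterates S (fun j => ζ j ω) u₀ (k + 1)))
      = ∑ n, (ζ k ⁻¹' {n}).indicator
          (fun ω => h (S n (blockIterates S (fun j => ζ j ω) u₀ k))) := by
  classical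
  ext ω
  rw [Finset.sum_apply, Finset.sum_eq_single (ζ k ω)]
  · simp [blockIterates]
  · intro n _ hn
    exact indicator_of_notMem (fun h => hn h.symm) _
  · simp

variable [mΩ : MeasurableSpace Ω]

/-- The filtration whose `k`-th σ-algebra is generated by `ζ 0, …, ζ (k - 1)`. -/
def selectionFiltration (ζ : ℕ → Ω → Fin N) (hζ : ∀ k, Measurable (ζ k)) : Filtration ℕ mΩ where
  seq k := ⨆ j ∈ Iio k, MeasurableSpace.comap (ζ j) inferInstance
  mono' _ _ hij := biSup_mono fun _ h => lt_of_lt_of_le h hij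
  le' _ := iSup₂_le fun j _ => (hζ j).comap_le

theorem BlockSelection.measureReal_eq {μ : Measure Ω} {ζ : ℕ → Ω → Fin N}
    (hζ : BlockSelection μ ζ) (k : ℕ) (n : Fin N) :
    μ.real (ζ k ⁻¹' {n}) = μ.real (ζ 0 ⁻¹' {n}) := by
  rw [Measure.real, Measure.real,
    (hζ.identDistrib k).measure_preimage_eq (measurableSet_singleton n)]

variable {μ : Measure Ω} [IsProbabilityMeasure μ] {ζ : ℕ → Ω → Fin N}

theorem stronglyMeasurable_comp_blockIterates (hζ : ∀ k, Measurable (ζ k)) (S : Fin N → U → U)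
    (u₀ : U) (k : ℕ) : ∀ h : U → ℝ, StronglyMeasurable[selectionFiltration ζ hζ k]
      fun ω => h (blockIterates S (fun j => ζ j ω) u₀ k) := by
  induction k with
  | zero => exact fun h => stronglyMeasurable_const (b := h u₀)
  | succ k ih =>
    intro h
    rw [comp_blockIterates_succ]
    refine Finset.stronglyMeasurable_sum _ fun n _ => ?_
    refine StronglyMeasurable.indicator
      ((ih fun u => h (S n u)).mono ((selectionFiltration ζ hζ).mono k.le_succ)) ?_
    exact le_iSup₂ (f := fun j (_ : j ∈ Iio (k + 1)) =>
      MeasurableSpace.comap (ζ j) inferInstance) k k.lt_succ_self _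
      ⟨{n}, measurableSet_singleton n, rfl⟩

theorem integrable_comp_blockIterates (hζ : ∀ k, Measurable (ζ k)) (S : Fin N → U → U)
    (u₀ : U) (k : ℕ) : ∀ h : U → ℝ,
      Integrable (fun ω => h (blockIterates S (fun j => ζ j ω) u₀ k)) μ := by
  induction k with
  | zero => exact fun h => integrable_const (h u₀)
  | succ k ih =>
    intro h
    rw [comp_blockIterates_succ]
    exact integrable_finsetSum' _ fun n _ =>
      (ih fun u => h (S n u)).indicator (hζ k (measurableSet_singleton n))

theorem BlockSelection.measureReal_pos (hζ : BlockSelection μ ζ) (n : Fin N) :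
    0 < μ.real (ζ 0 ⁻¹' {n}) :=
  ENNReal.toReal_pos (hζ.pos n).ne' (measure_ne_top _ _)

theorem BlockSelection.sum_measureReal (hζ : BlockSelection μ ζ) :
    ∑ n, μ.real (ζ 0 ⁻¹' {n}) = 1 := by
  have h := sum_measureReal_preimage_singleton (μ := μ) (f := ζ 0) Finset.univ
    (fun n _ => hζ.measurable 0 (measurableSet_singleton n))
  simpa using h

/-- Iterate `k` depends only on choices before `k`, and `ζ k` is independent of them, so
conditioning averages over the next block. -/
theorem BlockSelection.condExp_comp_blockIterates_succ (hζ : BlockSelection μ ζ)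
    (S : Fin N → U → U) (u₀ : U) (h : U → ℝ) (k : ℕ) :
    μ[fun ω => h (blockIterates S (fun j => ζ j ω) u₀ (k + 1)) |
        selectionFiltration ζ hζ.measurable k]
      =ᵐ[μ] fun ω => ∑ n, μ.real (ζ 0 ⁻¹' {n}) *
        h (S n (blockIterates S (fun j => ζ j ω) u₀ k)) := by
  have hms : ∀ n, MeasurableSet (ζ k ⁻¹' {n}) :=
    fun n => hζ.measurable k (measurableSet_singleton n)
  have hint : ∀ n, Integrable ((ζ k ⁻¹' {n}).indicator
      fun ω => h (S n (blockIterates S (fun j => ζ j ω) u₀ k))) μ := fun n =>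
    (integrable_comp_blockIterates hζ.measurable S u₀ k fun u => h (S n u)).indicator (hms n)
  have hind : Indep (MeasurableSpace.comap (ζ k) inferInstance)
      (selectionFiltration ζ hζ.measurable k) μ := by
    have h1 := indep_iSup_of_disjoint (fun j => (hζ.measurable j).comap_le) hζ.indep.iIndep
      (S := {k}) (T := Iio k) (by simp)
    rwa [iSup_singleton] at h1
  have hterm : ∀ n, μ[(ζ k ⁻¹' {n}).indicator
        (fun ω => h (S n (blockIterates S (fun j => ζ j ω) u₀ k))) |
        selectionFiltration ζ hζ.measurable k]
      =ᵐ[μ] fun ω => μ.real (ζ 0 ⁻¹' {n}) *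
        h (S n (blockIterates S (fun j => ζ j ω) u₀ k)) := by
    intro n
    have e : (ζ k ⁻¹' {n}).indicator (fun ω => h (S n (blockIterates S (fun j => ζ j ω) u₀ k)))
        = (ζ k ⁻¹' {n}).indicator (fun _ => (1 : ℝ)) *
          fun ω => h (S n (blockIterates S (fun j => ζ j ω) u₀ k)) := by
      ext ω
      by_cases hω : ω ∈ ζ k ⁻¹' {n} <;> simp [hω]
    have h2 := condExp_mul_of_stronglyMeasurable_right
      (f := (ζ k ⁻¹' {n}).indicator (fun _ => (1 : ℝ)))
      (stronglyMeasurable_comp_blockIterates hζ.measurable S u₀ k fun u => h (S n u))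
      (by rw [← e]; exact hint n) ((integrable_const (μ := μ) (1 : ℝ)).indicator (hms n))
    have h3 := condExp_indep_eq (f := (ζ k ⁻¹' {n}).indicator (fun _ => (1 : ℝ)))
      (hζ.measurable k).comap_le ((selectionFiltration ζ hζ.measurable).le k)
      (stronglyMeasurable_const.indicator ⟨{n}, measurableSet_singleton n, rfl⟩) hind
    rw [e]
    filter_upwards [h2, h3] with ω h2 h3
    rw [h2, Pi.mul_apply, h3, integral_indicator_const _ (hms n), smul_eq_mul, mul_one,
      hζ.measureReal_eq k n]
  rw [comp_blockIterates_succ]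
  refine (condExp_finsetSum (fun n _ => hint n) _).trans ?_
  have hall := ae_all_iff.2 hterm
  filter_upwards [hall] with ω hω
  rw [Finset.sum_apply]
  exact Finset.sum_congr rfl fun n _ => hω n

/-- Almost sure convergence of a nonnegative function that does not increase on average. -/
theorem BlockSelection.ae_exists_tendsto (hζ : BlockSelection μ ζ) (S : Fin N → U → U) (u₀ : U)
    {h : U → ℝ} (h0 : ∀ u, 0 ≤ h u) (hS : ∀ u, ∑ n, μ.real (ζ 0 ⁻¹' {n}) * h (S n u) ≤ h u) :
    ∀ᵐ ω ∂μ, ∃ l, Tendsto (fun k => h (blockIterates S (fun j => ζ j ω) u₀ k)) atTop (𝓝 l) := by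
  have hint := fun k => integrable_comp_blockIterates (μ := μ) hζ.measurable S u₀ k h
  have hsuper : Supermartingale (fun k ω => h (blockIterates S (fun j => ζ j ω) u₀ k))
      (selectionFiltration ζ hζ.measurable) μ := by
    refine supermartingale_nat
      (fun k => stronglyMeasurable_comp_blockIterates hζ.measurable S u₀ k h) hint fun k => ?_
    filter_upwards [hζ.condExp_comp_blockIterates_succ S u₀ h k] with ω hω
    rw [hω]
    exact hS _
  -- By nonnegativity the L¹ norm is the expectation, which never exceeds its initial value.
  have hbdd : ∀ k, eLpNorm ((-fun k ω => h (blockIterates S (fun j => ζ j ω) u₀ k)) k) 1 μ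
      ≤ ((h u₀).toNNReal : ℝ≥0) := by
    intro k
    have h1 := hsuper.setIntegral_le (Nat.zero_le k) MeasurableSet.univ
    rw [setIntegral_univ, setIntegral_univ] at h1
    simp only [blockIterates, integral_const, probReal_univ, smul_eq_mul, one_mul] at h1
    rw [Pi.neg_apply, eLpNorm_neg, eLpNorm_one_eq_lintegral_enorm,
      ← ofReal_integral_norm_eq_lintegral_enorm (hint k)]
    refine ENNReal.ofReal_le_ofReal (le_trans (le_of_eq ?_) h1)
    exact integral_congr_ae (ae_of_all _ fun ω => Real.norm_of_nonneg (h0 _))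
  filter_upwards [hsuper.neg.exists_ae_tendsto_of_bdd hbdd] with ω ⟨l, hl⟩
  refine ⟨-l, ?_⟩
  simpa using hl.neg

/-- A Robbins–Siegmund theorem for random block iterations: the guaranteed decrease of a
nonnegative function on average vanishes almost surely in the limit. -/
theorem BlockSelection.ae_tendsto_zero (hζ : BlockSelection μ ζ) (S : Fin N → U → U) (u₀ : U)
    {h r : U → ℝ} (h0 : ∀ u, 0 ≤ h u) (r0 : ∀ u, 0 ≤ r u)
    (hS : ∀ u, ∑ n, μ.real (ζ 0 ⁻¹' {n}) * h (S n u) ≤ h u - r u) :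
    ∀ᵐ ω ∂μ, Tendsto (fun k => r (blockIterates S (fun j => ζ j ω) u₀ k)) atTop (𝓝 0) := by
  -- The state also records the accumulated decrease; `h` plus this sum still does not increase on
  -- average. Both `h` and the total converge, hence so do the partial sums of `r`.
  set S' : Fin N → U × ℝ≥0 → U × ℝ≥0 := fun n p => (S n p.1, p.2 + (r p.1).toNNReal) with hS'
  have hfst : ∀ z : ℕ → Fin N, ∀ k,
      (blockIterates S' z (u₀, 0) k).1 = blockIterates S z u₀ k := by
    intro z k
    induction k with
    | zero => rfl
    | succ k ih => exact congrArg (S (z k)) ih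
  have h1 := hζ.ae_exists_tendsto S u₀ h0 fun u => (hS u).trans (sub_le_self _ (r0 u))
  have h2 := hζ.ae_exists_tendsto S' (u₀, 0) (h := fun p => h p.1 + p.2)
    (fun p => add_nonneg (h0 _) p.2.2) fun p => by
      have h3 := hS p.1
      simp only [hS', mul_add, Finset.sum_add_distrib, ← Finset.sum_mul, hζ.sum_measureReal,
        NNReal.coe_add, Real.coe_toNNReal _ (r0 p.1)]
      linarith
  filter_upwards [h1, h2] with ω ⟨l, hl⟩ ⟨l', hl'⟩
  have h4 : Tendsto (fun k => ((blockIterates S' (fun j => ζ j ω) (u₀, 0) k).2 : ℝ)) atTop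
      (𝓝 (l' - l)) := by
    refine (hl'.sub hl).congr fun k => ?_
    rw [hfst]
    ring
  have h5 := ((tendsto_add_atTop_iff_nat 1).2 h4).sub h4
  rw [sub_self] at h5
  refine h5.congr fun k => ?_
  have h6 : (blockIterates S' (fun j => ζ j ω) (u₀, 0) (k + 1)).2
      = (blockIterates S' (fun j => ζ j ω) (u₀, 0) k).2
        + (r (blockIterates S (fun j => ζ j ω) u₀ k)).toNNReal := by
    rw [← hfst]
    rfl
  rw [h6, NNReal.coe_add, Real.coe_toNNReal _ (r0 _)]
  ring

/-- The decrease also vanishes in the limit after any further block step. -/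
theorem BlockSelection.ae_tendsto_zero_step (hζ : BlockSelection μ ζ) (S : Fin N → U → U) (u₀ : U)
    {h r : U → ℝ} (h0 : ∀ u, 0 ≤ h u) (r0 : ∀ u, 0 ≤ r u)
    (hS : ∀ u, ∑ n, μ.real (ζ 0 ⁻¹' {n}) * h (S n u) ≤ h u - r u) :
    ∀ᵐ ω ∂μ, Tendsto (fun k => ∑ n, μ.real (ζ 0 ⁻¹' {n}) *
      r (S n (blockIterates S (fun j => ζ j ω) u₀ k))) atTop (𝓝 0) := by
  -- Averaging `h` and `r` over one more step preserves the descent inequality.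
  refine hζ.ae_tendsto_zero S u₀
    (h := fun u => ∑ n, μ.real (ζ 0 ⁻¹' {n}) * h (S n u))
    (r := fun u => ∑ n, μ.real (ζ 0 ⁻¹' {n}) * r (S n u))
    (fun u => Finset.sum_nonneg fun n _ => mul_nonneg measureReal_nonneg (h0 _))
    (fun u => Finset.sum_nonneg fun n _ => mul_nonneg measureReal_nonneg (r0 _)) fun u => ?_
  rw [← Finset.sum_sub_distrib]
  refine Finset.sum_le_sum fun n _ => ?_
  rw [← mul_sub]
  exact mul_le_mul_of_nonneg_left (hS _) measureReal_nonneg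

end BlockIterates

/-! ### Convergence from cluster points -/

section Opial

theorem eq_of_mapClusterPt_of_tendsto {α Y : Type*} [TopologicalSpace α] [TopologicalSpace Y]
    [T2Space Y] {u : ℕ → α} {a : α} {l : Y} {ψ : α → Y} (ha : MapClusterPt a atTop u)
    (hψ : ContinuousAt ψ a) (hl : Tendsto (fun k => ψ (u k)) atTop (𝓝 l)) : ψ a = l := by
  have h1 : MapClusterPt (ψ a) atTop (ψ ∘ u) := ha.continuousAt_comp hψ
  by_contra hne
  obtain ⟨s, hs, t, ht, hst⟩ := Filter.disjoint_iff.1 (disjoint_nhds_nhds.2 hne)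
  have h2 := (mapClusterPt_iff_frequently.1 h1 s hs).and_eventually (hl.eventually ht)
  obtain ⟨k, hk1, hk2⟩ := h2.exists
  exact Set.disjoint_left.1 hst hk1 hk2

/-- Opial's lemma, for a continuous function `V` in the place of the squared distance. -/
theorem exists_tendsto_of_cluster_mem {α : Type*} [TopologicalSpace α] {Z D K : Set α}
    {V : α → α → ℝ} (hV : Continuous fun p : α × α => V p.1 p.2) (hV0 : ∀ a, V a a = 0)
    (hVeq : ∀ a b, V a b = 0 → a = b) (hDZ : Z ⊆ closure D) {u : ℕ → α} (hK : IsCompact K)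
    (hu : ∀ k, u k ∈ K) (hlim : ∀ z ∈ D, ∃ l, Tendsto (fun k => V z (u k)) atTop (𝓝 l))
    (hcl : ∀ a, MapClusterPt a atTop u → a ∈ Z) : ∃ a ∈ Z, Tendsto u atTop (𝓝 a) := by
  obtain ⟨a, -, ha⟩ := hK.exists_mapClusterPt (u := u) (f := atTop)
    (tendsto_principal.2 (Eventually.of_forall hu))
  refine ⟨a, hcl a ha, hK.tendsto_nhds_of_unique_mapClusterPt (Eventually.of_forall hu)
    fun b _ hb => ?_⟩
  have hVc : ∀ z, Continuous (V z) := fun z => hV.comp (Continuous.prodMk_right z)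
  have heq : ∀ z ∈ D, V z a = V z b := fun z hz => by
    obtain ⟨l, hl⟩ := hlim z hz
    rw [eq_of_mapClusterPt_of_tendsto ha (hVc z).continuousAt hl,
      eq_of_mapClusterPt_of_tendsto hb (hVc z).continuousAt hl]
  -- Two cluster points `a`, `b` are equally far from each point of `D`, hence by density from `a`
  -- itself.
  have hclosed : IsClosed {z | V z a = V z b} :=
    isClosed_eq (hV.comp (Continuous.prodMk_left a)) (hV.comp (Continuous.prodMk_left b))
  have h1 : V a a = V a b := closure_minimal heq hclosed (hDZ (hcl a ha))
  exact (hVeq a b (by rw [← h1, hV0])).symm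

end Opial

/-! ### Block averages -/

section Average

variable {X : Type*} [AddCommGroup X] [Module ℝ X] {N : ℕ}

theorem sum_sub_avg (hN : N ≠ 0) (w : Fin N → X) : ∑ n, (w n - avg w) = 0 := by
  have hN' : (N : ℝ) ≠ 0 := Nat.cast_ne_zero.2 hN
  rw [Finset.sum_sub_distrib, Finset.sum_const, Finset.card_univ, Fintype.card_fin, avg,
    ← Nat.cast_smul_eq_nsmul ℝ, smul_smul, mul_inv_cancel₀ hN', one_smul, sub_self]

theorem avg_const (hN : N ≠ 0) (x : X) : avg (fun _ : Fin N => x) = x := by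
  have hN' : (N : ℝ) ≠ 0 := Nat.cast_ne_zero.2 hN
  rw [avg, Finset.sum_const, Finset.card_univ, Fintype.card_fin, ← Nat.cast_smul_eq_nsmul ℝ,
    smul_smul, inv_mul_cancel₀ hN', one_smul]

end Average

/-! ### The block metric and its weighted Lyapunov function -/

section Operator

variable {X : Type*} [NormedAddCommGroup X] {N : ℕ}

/-- The state of the algorithm as a family of blocks `(vₙ, yₙ, xₙ)`. -/
def State.toBlocks (u : State X N) (n : Fin N) : X × X × X :=
  (u.v n, u.y n, u.x n)

/-- The block metric `‖x‖² + λ (‖v‖² + ‖y‖²)`. -/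
noncomputable def blockNormSq (lam : ℝ) (e : X × X × X) : ℝ :=
  ‖e.2.2‖ ^ 2 + lam * (‖e.1‖ ^ 2 + ‖e.2.1‖ ^ 2)

/-- The squared block distance to `z`, with the blocks weighted by inverse probabilities. -/
noncomputable def lyapunov (lam : ℝ) (p : Fin N → ℝ) (z u : Fin N → X × X × X) : ℝ :=
  ∑ n, (p n)⁻¹ * blockNormSq lam (u n - z n)

theorem blockNormSq_nonneg {lam : ℝ} (hlam : 0 ≤ lam) (e : X × X × X) :
    0 ≤ blockNormSq lam e := by
  unfold blockNormSq
  positivity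

theorem mul_norm_sq_le_blockNormSq {lam : ℝ} (hlam : 0 ≤ lam) (hlam1 : lam ≤ 1) (e : X × X × X) :
    lam * ‖e‖ ^ 2 ≤ blockNormSq lam e := by
  have h1 : lam * ‖e.2.2‖ ^ 2 ≤ ‖e.2.2‖ ^ 2 := mul_le_of_le_one_left (sq_nonneg _) hlam1
  have h2 : 0 ≤ lam * ‖e.1‖ ^ 2 := by positivity
  have h3 : 0 ≤ lam * ‖e.2.1‖ ^ 2 := by positivity
  have h4 : 0 ≤ ‖e.2.2‖ ^ 2 := by positivity
  unfold blockNormSq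
  rw [Prod.norm_def, Prod.norm_def]
  rcases max_choice ‖e.1‖ (max ‖e.2.1‖ ‖e.2.2‖) with h | h <;> rw [h]
  · linarith
  · rcases max_choice ‖e.2.1‖ ‖e.2.2‖ with h | h <;> rw [h] <;> linarith

theorem lyapunov_nonneg {lam : ℝ} (hlam : 0 ≤ lam) {p : Fin N → ℝ} (hp : ∀ n, 0 < p n)
    (z u : Fin N → X × X × X) : 0 ≤ lyapunov lam p z u :=
  Finset.sum_nonneg fun n _ => mul_nonneg (inv_pos.2 (hp n)).le (blockNormSq_nonneg hlam _)

theorem lyapunov_self (lam : ℝ) (p : Fin N → ℝ) (z : Fin N → X × X × X) :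
    lyapunov lam p z z = 0 := by
  simp [lyapunov, blockNormSq]

theorem mul_dist_sq_le_lyapunov {lam : ℝ} (hlam : 0 ≤ lam) (hlam1 : lam ≤ 1) {p : Fin N → ℝ}
    (hp : ∀ n, 0 < p n) (hp1 : ∀ n, p n ≤ 1) (z u : Fin N → X × X × X) (n : Fin N) :
    lam * dist (u n) (z n) ^ 2 ≤ lyapunov lam p z u := by
  rw [dist_eq_norm]
  refine (mul_norm_sq_le_blockNormSq hlam hlam1 _).trans ?_
  refine le_trans ?_ (Finset.single_le_sum
    (f := fun m => (p m)⁻¹ * blockNormSq lam (u m - z m))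
    (fun m _ => mul_nonneg (inv_pos.2 (hp m)).le (blockNormSq_nonneg hlam _)) (Finset.mem_univ n))
  exact le_mul_of_one_le_left (blockNormSq_nonneg hlam _) ((one_le_inv₀ (hp n)).2 (hp1 n))

theorem eq_of_lyapunov_eq_zero {lam : ℝ} (hlam : 0 < lam) (hlam1 : lam ≤ 1) {p : Fin N → ℝ}
    (hp : ∀ n, 0 < p n) (hp1 : ∀ n, p n ≤ 1) {z u : Fin N → X × X × X}
    (h : lyapunov lam p z u = 0) : z = u := by
  ext1 n
  have h1 := mul_dist_sq_le_lyapunov hlam.le hlam1 hp hp1 z u n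
  rw [h] at h1
  have h2 : dist (u n) (z n) ^ 2 ≤ 0 := by
    by_contra! h3
    exact absurd h1 (not_le.2 (mul_pos hlam h3))
  exact (dist_eq_zero.1 (pow_eq_zero_iff two_ne_zero |>.1 (le_antisymm h2 (sq_nonneg _)))).symm

theorem continuous_blockNormSq (lam : ℝ) : Continuous (blockNormSq (X := X) lam) := by
  unfold blockNormSq
  fun_prop

theorem continuous_lyapunov (lam : ℝ) (p : Fin N → ℝ) :
    Continuous fun w : (Fin N → X × X × X) × (Fin N → X × X × X) =>
      lyapunov lam p w.1 w.2 := by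
  unfold lyapunov
  have := continuous_blockNormSq (X := X) lam
  fun_prop

/-- Updating block `n` changes the sum by `(p n)⁻¹` times the change in that block; averaging with
weight `p n` cancels the factor. -/
theorem sum_mul_lyapunov_update (lam : ℝ) {p : Fin N → ℝ} (hp : ∀ n, 0 < p n)
    (hp1 : ∑ n, p n = 1) (z u w : Fin N → X × X × X) :
    ∑ n, p n * lyapunov lam p z (Function.update u n (w n))
      = lyapunov lam p z u
        + (∑ n, blockNormSq lam (w n - z n) - ∑ n, blockNormSq lam (u n - z n)) := by
  have h : ∀ n, lyapunov lam p z (Function.update u n (w n)) = lyapunov lam p z u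
      + (p n)⁻¹ * (blockNormSq lam (w n - z n) - blockNormSq lam (u n - z n)) := by
    intro n
    unfold lyapunov
    rw [← Finset.add_sum_erase _ _ (Finset.mem_univ n),
      ← Finset.add_sum_erase _ (fun m => (p m)⁻¹ * blockNormSq lam (u m - z m))
        (Finset.mem_univ n), Function.update_self,
      Finset.sum_congr rfl fun m hm => by
        rw [Function.update_of_ne (Finset.ne_of_mem_erase hm)]]
    ring
  simp_rw [h, mul_add, Finset.sum_add_distrib, ← Finset.sum_mul, hp1, one_mul]
  congr 1
  rw [← Finset.sum_sub_distrib]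
  exact Finset.sum_congr rfl fun n _ => mul_inv_cancel_left₀ (hp n).ne' _

/-! ### The energy inequality and the update operators -/

variable [InnerProductSpace ℝ X]

/-- The energy inequality behind the primal-dual fixed point iteration with two dual variables. -/
theorem primal_dual_energy_le {lam : ℝ} (hlam : 0 ≤ lam) (hlam2 : lam ≤ 1 / 2) (s v y V Y : X)
    (hY : 0 ≤ inner ℝ Y (s + (1 - lam) • y - lam • v - Y)) :
    ‖s - lam • V - lam • Y‖ ^ 2 + lam * (‖V‖ ^ 2 + ‖Y‖ ^ 2)
      ≤ ‖s‖ ^ 2 + lam * (‖v‖ ^ 2 + ‖y‖ ^ 2) - lam ^ 2 * ‖v + y‖ ^ 2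
        - lam / 2 * ‖(V - v) - (Y - y)‖ ^ 2
        - 2 * lam * inner ℝ V (s + (1 - lam) • v - lam • y - V) := by
  -- By the parallelogram law, the right side minus the left is exactly this term plus 2λ times the
  -- product in `hY`. It is dropped, as it vanishes at λ = 1/2.
  have h1 : 0 ≤ lam * (1 / 2 - lam) * ‖(V - v) + (Y - y)‖ ^ 2 :=
    mul_nonneg (mul_nonneg hlam (by linarith)) (sq_nonneg _)
  have h2 := mul_nonneg hlam hY
  simp only [← real_inner_self_eq_norm_sq, inner_add_left, inner_sub_left, inner_add_right,
    inner_sub_right, real_inner_smul_left, real_inner_smul_right] at h1 h2 ⊢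
  simp only [real_inner_comm s V, real_inner_comm s Y,
    real_inner_comm v y, real_inner_comm v V, real_inner_comm v Y, real_inner_comm y V,
    real_inner_comm y Y, real_inner_comm V Y] at h1 h2 ⊢
  linarith

variable [CompleteSpace X]

section Definitions

variable (f : Fin N → X → ℝ) (g : Fin N → X → EReal) (γ lam : ℝ)

/-- The forward (gradient) step in block `n`. -/
noncomputable def forward (n : Fin N) (x : X) : X :=
  x - γ • gradient (f n) x

/-- The argument of the projection in the `v`-update. -/
noncomputable def vArg (u : Fin N → X × X × X) (n : Fin N) : X :=
  forward f γ n (u n).2.2 + (1 - lam) • (u n).1 - lam • (u n).2.1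

/-- The argument of the proximity operator in the `y`-update. -/
noncomputable def yArg (u : Fin N → X × X × X) (n : Fin N) : X :=
  forward f γ n (u n).2.2 + (1 - lam) • (u n).2.1 - lam • (u n).1

noncomputable def vNext (u : Fin N → X × X × X) (n : Fin N) : X :=
  vArg f γ lam u n - avg (vArg f γ lam u)

noncomputable def yNext (u : Fin N → X × X × X) (n : Fin N) : X :=
  yArg f γ lam u n - prox (fun z => ((γ / lam : ℝ) : EReal) * g n z) (yArg f γ lam u n)

noncomputable def xNext (u : Fin N → X × X × X) (n : Fin N) : X :=
  forward f γ n (u n).2.2 - lam • vNext f γ lam u n - lam • yNext f g γ lam u n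

/-- The operator that updates all blocks simultaneously. -/
noncomputable def fullStep (u : Fin N → X × X × X) (n : Fin N) : X × X × X :=
  (vNext f γ lam u n, yNext f g γ lam u n, xNext f g γ lam u n)

/-- The operator that updates block `n` only. -/
noncomputable def blockStep (n : Fin N) (u : Fin N → X × X × X) : Fin N → X × X × X :=
  Function.update u n (fullStep f g γ lam u n)

/-- The guaranteed decrease of the block distance to the fixed point `z` in a full step. -/
noncomputable def residual (β : ℝ) (z u : Fin N → X × X × X) : ℝ :=
  ∑ n, (γ * (2 * β - γ) * ‖gradient (f n) (u n).2.2 - gradient (f n) (z n).2.2‖ ^ 2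
    + lam ^ 2 * ‖((u n).1 + (u n).2.1) - ((z n).1 + (z n).2.1)‖ ^ 2
    + lam / 2 * ‖(vNext f γ lam u n - (u n).1) - (yNext f g γ lam u n - (u n).2.1)‖ ^ 2)

end Definitions

variable {f : Fin N → X → ℝ} {g : Fin N → X → EReal} {γ lam β : ℝ}

/-- The point `zbar` is the mean of the arguments `vArg`, so the `v`-update projects onto the block
vectors of zero sum. -/
theorem toBlocks_step (n : Fin N) (u : State X N) :
    (step f g γ lam n u).toBlocks = blockStep f g γ lam n u.toBlocks := by
  have havg : avg (fun m => u.x m - γ • gradient (f m) (u.x m) - lam • u.y m)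
      + (1 - lam) • avg u.v = avg (vArg f γ lam u.toBlocks) := by
    rw [avg, avg, avg, smul_comm (1 - lam), ← smul_add, Finset.smul_sum, ← Finset.sum_add_distrib]
    refine congrArg _ (Finset.sum_congr rfl fun m _ => ?_)
    simp only [vArg, forward, State.toBlocks]
    abel
  ext1 m
  rcases eq_or_ne m n with rfl | hm
  · simp only [step, State.toBlocks, Function.update_self, blockStep, havg]
    rfl
  · simp [step, State.toBlocks, blockStep, hm]

theorem toBlocks_iterates (ζ : ℕ → Fin N) (u₀ : State X N) (k : ℕ) :
    (iterates f g γ lam ζ u₀ k).toBlocks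
      = blockIterates (blockStep f g γ lam) ζ u₀.toBlocks k := by
  induction k with
  | zero => rfl
  | succ k ih => rw [iterates, toBlocks_step, ih, blockIterates]

theorem residual_term_nonneg (hγ : 0 ≤ γ) (hγβ : γ ≤ 2 * β) (hlam : 0 ≤ lam)
    (z u : Fin N → X × X × X) (n : Fin N) :
    0 ≤ γ * (2 * β - γ) * ‖gradient (f n) (u n).2.2 - gradient (f n) (z n).2.2‖ ^ 2
    + lam ^ 2 * ‖((u n).1 + (u n).2.1) - ((z n).1 + (z n).2.1)‖ ^ 2
    + lam / 2 * ‖(vNext f γ lam u n - (u n).1) - (yNext f g γ lam u n - (u n).2.1)‖ ^ 2 := by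
  have : 0 ≤ 2 * β - γ := sub_nonneg.2 hγβ
  positivity

theorem residual_nonneg (hγ : 0 ≤ γ) (hγβ : γ ≤ 2 * β) (hlam : 0 ≤ lam)
    (z u : Fin N → X × X × X) : 0 ≤ residual f g γ lam β z u :=
  Finset.sum_nonneg fun n _ => residual_term_nonneg hγ hγβ hlam z u n

/-- Orthogonality of zero-sum and constant block vectors; it removes the last term of the energy
inequality, but only after summing over blocks. -/
theorem sum_inner_vNext_eq_zero (hN : N ≠ 0) (z u : Fin N → X × X × X) :
    ∑ n, inner ℝ (vNext f γ lam u n - vNext f γ lam z n)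
      ((vArg f γ lam u n - vArg f γ lam z n) - (vNext f γ lam u n - vNext f γ lam z n)) = 0 := by
  have e : ∀ n, (vArg f γ lam u n - vArg f γ lam z n) - (vNext f γ lam u n - vNext f γ lam z n)
      = avg (vArg f γ lam u) - avg (vArg f γ lam z) := fun n => by
    simp only [vNext]; abel
  simp_rw [e]
  rw [← sum_inner, Finset.sum_sub_distrib]
  simp only [vNext, sum_sub_avg hN, sub_self, inner_zero_left]

/-- Zero residual at `u` makes the increments of v and y equal; zero residual after updating block
`n` makes v + y unchanged there, so they are also opposite, hence zero. The x-increment then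
vanishes because gradient and v + y agree with those of `z`. -/
theorem fullStep_eq_of_residual_eq_zero (hγ : 0 < γ) (hγβ : γ < 2 * β) (hlam : 0 < lam)
    {z : Fin N → X × X × X} (hz : fullStep f g γ lam z = z) {u : Fin N → X × X × X}
    (h0 : residual f g γ lam β z u = 0)
    (h1 : ∀ n, residual f g γ lam β z (blockStep f g γ lam n u) = 0) :
    fullStep f g γ lam u = u := by
  have hv : ∀ n, vNext f γ lam z n = (z n).1 := fun n => congrArg Prod.fst (congrFun hz n)
  have hy : ∀ n, yNext f g γ lam z n = (z n).2.1 := fun n =>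
    congrArg (fun e => e.2.1) (congrFun hz n)
  have hx : ∀ n, forward f γ n (z n).2.2 - lam • (z n).1 - lam • (z n).2.1 = (z n).2.2 :=
    fun n => by
      rw [← hv n, ← hy n]
      exact congrArg (fun e => e.2.2) (congrFun hz n)
  have key : ∀ w : Fin N → X × X × X, residual f g γ lam β z w = 0 → ∀ n,
      gradient (f n) (w n).2.2 = gradient (f n) (z n).2.2 ∧
      (w n).1 + (w n).2.1 = (z n).1 + (z n).2.1 ∧
      vNext f γ lam w n - (w n).1 = yNext f g γ lam w n - (w n).2.1 := by
    intro w hw n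
    have hn := (Finset.sum_eq_zero_iff_of_nonneg fun n _ =>
      residual_term_nonneg hγ.le hγβ.le hlam.le z w n).1 hw n (Finset.mem_univ n)
    have hpos : 0 < 2 * β - γ := sub_pos.2 hγβ
    rw [add_eq_zero_iff_of_nonneg (by positivity) (by positivity),
      add_eq_zero_iff_of_nonneg (by positivity) (by positivity)] at hn
    have hzero : ∀ {c : ℝ} {a b : X}, 0 < c → c * ‖a - b‖ ^ 2 = 0 → a = b := fun hc hab =>
      sub_eq_zero.1 (norm_eq_zero.1 (pow_eq_zero_iff two_ne_zero |>.1
        ((mul_eq_zero.1 hab).resolve_left hc.ne')))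
    exact ⟨hzero (by positivity) hn.1.1, hzero (by positivity) hn.1.2,
      hzero (by positivity) hn.2⟩
  ext1 n
  obtain ⟨ha, hb, hc⟩ := key u h0 n
  have hd := (key _ (h1 n) n).2.1
  simp only [blockStep, Function.update_self, fullStep] at hd
  have hvu : vNext f γ lam u n = (u n).1 := by
    have h2 : (2 : ℝ) • (vNext f γ lam u n - (u n).1) = 0 := by
      have h3 : (2 : ℝ) • (vNext f γ lam u n - (u n).1)
          = (vNext f γ lam u n - (u n).1) + (yNext f g γ lam u n - (u n).2.1) := by
        rw [← hc, two_smul]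
      rw [h3, sub_add_sub_comm, hd, hb, sub_self]
    exact sub_eq_zero.1 ((smul_eq_zero.1 h2).resolve_left two_ne_zero)
  have hyu : yNext f g γ lam u n = (u n).2.1 := by
    rw [hvu, sub_self] at hc
    exact sub_eq_zero.1 hc.symm
  have hxu : xNext f g γ lam u n = (u n).2.2 := by
    have h2 := hx n
    rw [sub_sub, ← smul_add, ← hb, forward, ← ha, sub_sub, sub_eq_self] at h2
    rw [xNext, hvu, hyu, forward, sub_sub, sub_sub, ← smul_add, h2, sub_zero]
  rw [fullStep, hvu, hyu, hxu]

theorem MinibatchAssumption.continuous_gradient (h : MinibatchAssumption β f g) (n : Fin N) :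
    Continuous (gradient (f n)) := by
  refine (LipschitzWith.of_dist_le_mul (K := (1 / β).toNNReal) fun x y => ?_).continuous
  rw [dist_eq_norm, dist_eq_norm, Real.coe_toNNReal _ (one_div_pos.2 h.beta_pos).le]
  exact h.f_lipschitz n x y

theorem MinibatchAssumption.continuous_vArg (h : MinibatchAssumption β f g) (n : Fin N) :
    Continuous fun u : Fin N → X × X × X => vArg f γ lam u n := by
  have := h.continuous_gradient n
  unfold vArg forward
  fun_prop

theorem MinibatchAssumption.continuous_vNext (h : MinibatchAssumption β f g) (n : Fin N) :
    Continuous fun u : Fin N → X × X × X => vNext f γ lam u n := by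
  have := h.continuous_vArg (γ := γ) (lam := lam)
  unfold vNext avg
  fun_prop

/-! ### Descent, fixed points and continuity of the operators -/

variable [FiniteDimensional ℝ X]

theorem MinibatchAssumption.exists_hasSubgradient (h : MinibatchAssumption β f g) (n : Fin N) :
    ∃ τ w x, HasSubgradient (g n) τ w x := by
  obtain ⟨x, τ, ℓ, hℓ, -⟩ := h.exists_certificate
  exact ⟨τ n, ℓ n, x, hℓ n⟩

theorem MinibatchAssumption.sum_blockNormSq_fullStep_le (h : MinibatchAssumption β f g)
    (hN : N ≠ 0) (hγ : 0 < γ) (hlam : 0 < lam) (hlam2 : lam ≤ 1 / 2)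
    {z : Fin N → X × X × X} (hz : fullStep f g γ lam z = z) (u : Fin N → X × X × X) :
    ∑ n, blockNormSq lam (fullStep f g γ lam u n - z n)
      ≤ ∑ n, blockNormSq lam (u n - z n) - residual f g γ lam β z u := by
  have hv : ∀ n, vNext f γ lam z n = (z n).1 := fun n => congrArg Prod.fst (congrFun hz n)
  have hy : ∀ n, yNext f g γ lam z n = (z n).2.1 := fun n =>
    congrArg (fun e => e.2.1) (congrFun hz n)
  have hx : ∀ n, xNext f g γ lam z n = (z n).2.2 := fun n =>
    congrArg (fun e => e.2.2) (congrFun hz n)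
  have hsum := sum_inner_vNext_eq_zero (f := f) (γ := γ) (lam := lam) hN z u
  have hblock : ∀ n, blockNormSq lam (fullStep f g γ lam u n - z n)
      ≤ blockNormSq lam (u n - z n)
        - (γ * (2 * β - γ) * ‖gradient (f n) (u n).2.2 - gradient (f n) (z n).2.2‖ ^ 2
          + lam ^ 2 * ‖((u n).1 + (u n).2.1) - ((z n).1 + (z n).2.1)‖ ^ 2
          + lam / 2 *
            ‖(vNext f γ lam u n - (u n).1) - (yNext f g γ lam u n - (u n).2.1)‖ ^ 2)
        - 2 * lam * inner ℝ (vNext f γ lam u n - vNext f γ lam z n)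
          ((vArg f γ lam u n - vArg f γ lam z n)
            - (vNext f γ lam u n - vNext f γ lam z n)) := by
    intro n
    obtain ⟨τ, w, x₀, hsub⟩ := h.exists_hasSubgradient n
    have hc : 0 < γ / lam := div_pos hγ hlam
    have hfirm := inner_sub_prox_nonneg ((h.g_gammaZero n).const_mul hc) (hsub.const_mul hc)
      (yArg f γ lam u n) (yArg f γ lam z n)
    have hfwd := norm_sq_gradient_step_le h.beta_pos hγ.le (h.f_convex n) (h.f_diff n)
      (h.f_lipschitz n) (u n).2.2 (z n).2.2
    have henergy := primal_dual_energy_le hlam.le hlam2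
      (forward f γ n (u n).2.2 - forward f γ n (z n).2.2) ((u n).1 - (z n).1)
      ((u n).2.1 - (z n).2.1) (vNext f γ lam u n - vNext f γ lam z n)
      (yNext f g γ lam u n - yNext f g γ lam z n) (by
        refine hfirm.trans_eq (congrArg₂ _ rfl ?_)
        simp only [yNext, yArg]
        module)
    have e1 : forward f γ n (u n).2.2 - forward f γ n (z n).2.2
          - lam • (vNext f γ lam u n - vNext f γ lam z n)
          - lam • (yNext f g γ lam u n - yNext f g γ lam z n)
        = xNext f g γ lam u n - (z n).2.2 := by
      conv_rhs => rw [← hx n]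
      simp only [xNext]
      module
    have e2 : forward f γ n (u n).2.2 - forward f γ n (z n).2.2
          + (1 - lam) • ((u n).1 - (z n).1) - lam • ((u n).2.1 - (z n).2.1)
        = vArg f γ lam u n - vArg f γ lam z n := by
      simp only [vArg]
      module
    have e3 : (u n).1 - (z n).1 + ((u n).2.1 - (z n).2.1)
        = ((u n).1 + (u n).2.1) - ((z n).1 + (z n).2.1) := by abel
    have e4 : vNext f γ lam u n - vNext f γ lam z n - ((u n).1 - (z n).1)
          - (yNext f g γ lam u n - yNext f g γ lam z n - ((u n).2.1 - (z n).2.1))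
        = (vNext f γ lam u n - (u n).1) - (yNext f g γ lam u n - (u n).2.1) := by
      rw [hv, hy]
      abel
    rw [e1, e2, e3, e4] at henergy
    have e5 : blockNormSq lam (fullStep f g γ lam u n - z n)
        = ‖xNext f g γ lam u n - (z n).2.2‖ ^ 2 + lam *
          (‖vNext f γ lam u n - vNext f γ lam z n‖ ^ 2
            + ‖yNext f g γ lam u n - yNext f g γ lam z n‖ ^ 2) := by
      rw [hv, hy]
      rfl
    have e6 : blockNormSq lam (u n - z n) = ‖(u n).2.2 - (z n).2.2‖ ^ 2
        + lam * (‖(u n).1 - (z n).1‖ ^ 2 + ‖(u n).2.1 - (z n).2.1‖ ^ 2) := rfl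
    rw [e5, e6]
    simp only [forward] at henergy
    linarith
  have htot := Finset.sum_le_sum fun n (_ : n ∈ Finset.univ) => hblock n
  rw [Finset.sum_sub_distrib, Finset.sum_sub_distrib, ← Finset.mul_sum, hsum, mul_zero,
    sub_zero] at htot
  exact htot

theorem MinibatchAssumption.exists_fullStep_eq (h : MinibatchAssumption β f g) (hN : N ≠ 0)
    (hγ : 0 < γ) (hlam : 0 < lam) : ∃ z : Fin N → X × X × X, fullStep f g γ lam z = z := by
  obtain ⟨x₀, τ, ℓ, hℓ, hsum⟩ := h.exists_certificate
  have hc : 0 < γ / lam := div_pos hγ hlam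
  -- The choice makes λ(v + y) cancel the gradient step, y a subgradient of (γ/λ) g_n, and ∑ v = 0
  -- by the balance condition.
  set z : Fin N → X × X × X := fun n =>
    (-((γ / lam) • (gradient (f n) x₀ + ℓ n)), (γ / lam) • ℓ n, x₀) with hz
  have hdual : ∀ n, lam • ((z n).1 + (z n).2.1) = -(γ • gradient (f n) x₀) := fun n => by
    have e : (z n).1 + (z n).2.1 = -((γ / lam) • gradient (f n) x₀) := by
      simp only [hz]; module
    rw [e, smul_neg, smul_smul, mul_div_cancel₀ _ hlam.ne']
  have hvArg : ∀ n, vArg f γ lam z n = x₀ + (z n).1 := fun n => by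
    have e : vArg f γ lam z n
        = x₀ - γ • gradient (f n) x₀ + (z n).1 - lam • ((z n).1 + (z n).2.1) := by
      simp only [vArg, forward, hz]; module
    rw [e, hdual]; abel
  have hyArg : ∀ n, yArg f γ lam z n = x₀ + (z n).2.1 := fun n => by
    have e : yArg f γ lam z n
        = x₀ - γ • gradient (f n) x₀ + (z n).2.1 - lam • ((z n).1 + (z n).2.1) := by
      simp only [yArg, forward, hz]; module
    rw [e, hdual]; abel
  have hvsum : ∑ n, (z n).1 = 0 := by
    simp only [hz, Finset.sum_neg_distrib, ← Finset.smul_sum, hsum, smul_zero, neg_zero]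
  have havg : avg (vArg f γ lam z) = x₀ := by
    have e : vArg f γ lam z = fun n => x₀ + (z n).1 := funext hvArg
    rw [e, avg, Finset.sum_add_distrib, hvsum, add_zero]
    exact avg_const hN x₀
  have hv : ∀ n, vNext f γ lam z n = (z n).1 := fun n => by
    rw [vNext, havg, hvArg, add_sub_cancel_left]
  have hy : ∀ n, yNext f g γ lam z n = (z n).2.1 := fun n => by
    have hp := prox_eq_of_hasSubgradient (x := x₀ + (z n).2.1) ((h.g_gammaZero n).const_mul hc)
      (by rw [add_sub_cancel_left]; exact (hℓ n).const_mul hc)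
    rw [yNext, hyArg, hp, add_sub_cancel_left]
  refine ⟨z, funext fun n => ?_⟩
  have hx : xNext f g γ lam z n = (z n).2.2 := by
    have e : xNext f g γ lam z n
        = x₀ - γ • gradient (f n) x₀ - lam • ((z n).1 + (z n).2.1) := by
      rw [xNext, hv, hy, forward, sub_sub, smul_add]
    rw [e, hdual, sub_neg_eq_add, sub_add_cancel]
  rw [fullStep, hv, hy, hx]

theorem MinibatchAssumption.exists_isMinimizer_of_fullStep_eq (h : MinibatchAssumption β f g)
    (hN : N ≠ 0) (hγ : 0 < γ) (hlam : 0 < lam) {z : Fin N → X × X × X}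
    (hz : fullStep f g γ lam z = z) :
    ∃ x₀, (∀ n, (z n).2.2 = x₀) ∧ IsMinimizer (liftedObjective f g) fun _ => x₀ := by
  have hc : 0 < γ / lam := div_pos hγ hlam
  have hv : ∀ n, vNext f γ lam z n = (z n).1 := fun n => congrArg Prod.fst (congrFun hz n)
  have hy : ∀ n, yNext f g γ lam z n = (z n).2.1 := fun n =>
    congrArg (fun e => e.2.1) (congrFun hz n)
  have hx : ∀ n, forward f γ n (z n).2.2 - lam • (z n).1 - lam • (z n).2.1 = (z n).2.2 :=
    fun n => by
      rw [← hv n, ← hy n]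
      exact congrArg (fun e => e.2.2) (congrFun hz n)
  set x₀ := avg (vArg f γ lam z) with hx₀
  -- At a fixed point `vArg` is x + v, so subtracting its mean returns v only if every x equals that
  -- mean.
  have hcons : ∀ n, (z n).2.2 = x₀ := fun n => by
    have h1 := hv n
    have h2 : vArg f γ lam z n = (z n).2.2 + (z n).1 := by
      rw [add_comm, ← sub_eq_iff_eq_add', ← hx n]
      simp only [vArg]
      module
    rw [vNext, h2, ← hx₀] at h1
    rwa [add_sub_right_comm, add_eq_right, sub_eq_zero] at h1
  have hgrad : ∀ n, gradient (f n) x₀ + (γ / lam)⁻¹ • (z n).2.1 = -((γ / lam)⁻¹ • (z n).1) :=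
    fun n => by
      have h1 := hx n
      rw [hcons n, forward] at h1
      have h2 : γ • gradient (f n) x₀ = -(lam • ((z n).1 + (z n).2.1)) := by
        rw [← sub_eq_zero] at h1 ⊢
        rw [← neg_eq_zero, ← h1]
        module
      have h3 : gradient (f n) x₀ = -((γ / lam)⁻¹ • ((z n).1 + (z n).2.1)) := by
        rw [inv_div, div_eq_inv_mul, ← smul_smul, ← smul_neg, ← h2, smul_smul,
          inv_mul_cancel₀ hγ.ne', one_smul]
      rw [h3]
      module
  have hsub : ∀ n, ∃ τ : ℝ, HasSubgradient (g n) τ ((γ / lam)⁻¹ • (z n).2.1) x₀ := fun n => by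
    obtain ⟨τ, w, x', hsub⟩ := h.exists_hasSubgradient n
    obtain ⟨σ, hσ⟩ := hasSubgradient_prox ((h.g_gammaZero n).const_mul hc) (hsub.const_mul hc)
      (yArg f γ lam z n)
    have h1 : yArg f γ lam z n - prox (fun z => ((γ / lam : ℝ) : EReal) * g n z)
        (yArg f γ lam z n) = (z n).2.1 := hy n
    have h2 : yArg f γ lam z n = (z n).2.2 + (z n).2.1 := by
      rw [add_comm, ← sub_eq_iff_eq_add', ← hx n]
      simp only [yArg]
      module
    have h3 : prox (fun z => ((γ / lam : ℝ) : EReal) * g n z) (yArg f γ lam z n) = x₀ := by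
      rw [← hcons n, ← sub_eq_iff_eq_add.2 h2, ← h1, sub_sub_cancel]
    rw [h1, h3] at hσ
    have h4 := hσ.const_mul (inv_pos.2 hc)
    have e : (fun z => (((γ / lam)⁻¹ : ℝ) : EReal) * (((γ / lam : ℝ) : EReal) * g n z)) = g n := by
      ext1 z
      rw [← mul_assoc, ← EReal.coe_mul, inv_mul_cancel₀ hc.ne', EReal.coe_one, one_mul]
    rw [e] at h4
    exact ⟨_, h4⟩
  choose τ hτ using hsub
  refine ⟨x₀, hcons, h.isMinimizer_liftedObjective hτ ?_⟩
  have hvsum : ∑ n, (z n).1 = 0 := by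
    rw [← sum_sub_avg hN (vArg f γ lam z)]
    exact Finset.sum_congr rfl fun n _ => (hv n).symm
  simp_rw [hgrad, Finset.sum_neg_distrib, ← Finset.smul_sum, hvsum, smul_zero, neg_zero]

theorem MinibatchAssumption.continuous_yNext (h : MinibatchAssumption β f g) (hγ : 0 < γ)
    (hlam : 0 < lam) (n : Fin N) :
    Continuous fun u : Fin N → X × X × X => yNext f g γ lam u n := by
  have h1 := h.continuous_gradient n
  obtain ⟨τ, w, x', hsub⟩ := h.exists_hasSubgradient n
  have hc : 0 < γ / lam := div_pos hγ hlam
  have h2 := continuous_prox ((h.g_gammaZero n).const_mul hc) (hsub.const_mul hc)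
  unfold yNext yArg forward
  fun_prop

theorem MinibatchAssumption.continuous_blockStep (h : MinibatchAssumption β f g) (hγ : 0 < γ)
    (hlam : 0 < lam) (n : Fin N) : Continuous (blockStep f g γ lam n) := by
  have h1 := h.continuous_gradient n
  have h2 := h.continuous_vNext (γ := γ) (lam := lam) n
  have h3 := h.continuous_yNext hγ hlam n
  refine continuous_id.update n ?_
  unfold fullStep xNext forward
  fun_prop

theorem MinibatchAssumption.continuous_residual (h : MinibatchAssumption β f g) (hγ : 0 < γ)
    (hlam : 0 < lam) (z : Fin N → X × X × X) : Continuous (residual f g γ lam β z) := by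
  have h1 := h.continuous_gradient
  have h2 := h.continuous_vNext (γ := γ) (lam := lam)
  have h3 := h.continuous_yNext hγ hlam
  unfold residual
  fun_prop

end Operator

/-! ### Almost sure convergence -/

/-- Almost sure convergence of the random block iteration to a fixed point of the full step. -/
theorem MinibatchAssumption.ae_exists_tendsto_blockIterates {X : Type*} [NormedAddCommGroup X]
    [InnerProductSpace ℝ X] [FiniteDimensional ℝ X] [CompleteSpace X] {N : ℕ} (hN : N ≠ 0)
    {f : Fin N → X → ℝ} {g : Fin N → X → EReal} {β γ lam : ℝ} (h : MinibatchAssumption β f g)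
    (hγ : 0 < γ) (hγβ : γ < 2 * β) (hlam : 0 < lam) (hlam2 : lam ≤ 1 / 2)
    {Ω : Type*} [MeasurableSpace Ω] {μ : Measure Ω} [IsProbabilityMeasure μ]
    {ζ : ℕ → Ω → Fin N} (hζ : BlockSelection μ ζ) (u₀ : Fin N → X × X × X) :
    ∀ᵐ ω ∂μ, ∃ z ∈ {z | fullStep f g γ lam z = z},
      Tendsto (blockIterates (blockStep f g γ lam) (fun j => ζ j ω) u₀) atTop (𝓝 z) := by
  have hlam1 : lam ≤ 1 := hlam2.trans (by norm_num)
  set p : Fin N → ℝ := fun n => μ.real (ζ 0 ⁻¹' {n}) with hp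
  have hp0 : ∀ n, 0 < p n := hζ.measureReal_pos
  have hpsum : ∑ n, p n = 1 := hζ.sum_measureReal
  have hp1 : ∀ n, p n ≤ 1 := fun n => measureReal_le_one
  set Z : Set (Fin N → X × X × X) := {z | fullStep f g γ lam z = z} with hZ
  obtain ⟨z₀, hz₀⟩ : ∃ z, z ∈ Z := h.exists_fullStep_eq hN hγ hlam
  -- The null set where the distance to `z` fails to converge depends on `z`; a countable dense set
  -- of fixed points leaves one null set.
  obtain ⟨D, hDZ, hDc, hDd⟩ :=
    (TopologicalSpace.IsSeparable.of_separableSpace Z).exists_countable_dense_subset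
  have hdesc : ∀ z ∈ Z, ∀ u, ∑ n, μ.real (ζ 0 ⁻¹' {n}) *
      lyapunov lam p z (blockStep f g γ lam n u)
        ≤ lyapunov lam p z u - residual f g γ lam β z u := by
    intro z hz u
    have h1 := h.sum_blockNormSq_fullStep_le hN hγ hlam hlam2 hz u
    have h2 := sum_mul_lyapunov_update lam hp0 hpsum z u (fullStep f g γ lam u)
    exact (le_of_eq h2).trans (by linarith)
  have hV0 : ∀ z u : Fin N → X × X × X, 0 ≤ lyapunov lam p z u := lyapunov_nonneg hlam.le hp0
  have hr0 : ∀ z u : Fin N → X × X × X, 0 ≤ residual f g γ lam β z u :=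
    residual_nonneg hγ.le hγβ.le hlam.le
  have hlimit : ∀ z ∈ Z, ∀ᵐ ω ∂μ, ∃ l, Tendsto (fun k => lyapunov lam p z
      (blockIterates (blockStep f g γ lam) (fun j => ζ j ω) u₀ k)) atTop (𝓝 l) := fun z hz =>
    hζ.ae_exists_tendsto _ u₀ (hV0 z) fun u => (hdesc z hz u).trans (sub_le_self _ (hr0 z u))
  have hres := hζ.ae_tendsto_zero (blockStep f g γ lam) u₀ (hV0 z₀) (hr0 z₀) (hdesc z₀ hz₀)
  have hres' := hζ.ae_tendsto_zero_step (blockStep f g γ lam) u₀ (hV0 z₀) (hr0 z₀)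
    (hdesc z₀ hz₀)
  filter_upwards [(ae_ball_iff hDc).2 fun z hz => hlimit z (hDZ hz), hlimit z₀ hz₀, hres, hres']
    with ω hω₁ ⟨l, hl⟩ hω₂ hω₃
  obtain ⟨C, hC⟩ := hl.bddAbove_range
  refine exists_tendsto_of_cluster_mem (continuous_lyapunov lam p) (lyapunov_self lam p)
    (fun a b => eq_of_lyapunov_eq_zero hlam hlam1 hp0 hp1) hDd
    (isCompact_closedBall z₀ (Real.sqrt (C / lam))) (fun k => ?_) hω₁ fun a ha => ?_
  · rw [Metric.mem_closedBall, dist_pi_le_iff (Real.sqrt_nonneg _)]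
    intro n
    refine Real.le_sqrt_of_sq_le ?_
    rw [le_div_iff₀ hlam, mul_comm]
    exact (mul_dist_sq_le_lyapunov hlam.le hlam1 hp0 hp1 z₀ _ n).trans (hC ⟨k, rfl⟩)
  -- By continuity a cluster point has zero residual, both itself and, as each block has positive
  -- probability, after updating any block.
  · have hc := h.continuous_residual hγ hlam z₀
    have h1 := eq_of_mapClusterPt_of_tendsto ha hc.continuousAt hω₂
    have hc' : Continuous fun u => ∑ n, μ.real (ζ 0 ⁻¹' {n}) *
        residual f g γ lam β z₀ (blockStep f g γ lam n u) := by
      have hb := h.continuous_blockStep hγ hlam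
      fun_prop
    have h2 := eq_of_mapClusterPt_of_tendsto ha hc'.continuousAt hω₃
    refine fullStep_eq_of_residual_eq_zero hγ hγβ hlam hz₀ h1 fun n => ?_
    have h3 := (Finset.sum_eq_zero_iff_of_nonneg fun n _ =>
      mul_nonneg (hp0 n).le (hr0 z₀ _)).1 h2 n (Finset.mem_univ n)
    exact (mul_eq_zero.1 h3).resolve_left (hp0 n).ne'

end SMSPDFP

theorem theorem4p2 {X : Type*} [NormedAddCommGroup X] [InnerProductSpace ℝ X]
    [FiniteDimensional ℝ X] [CompleteSpace X] {N : ℕ} (hN : 1 < N)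
    (f : Fin N → X → ℝ) (g : Fin N → X → EReal) (β γ lam : ℝ)
    (hfg : SMSPDFP.MinibatchAssumption β f g)
    (hγ : 0 < γ) (hγβ : γ < 2 * β) (hlam : 0 < lam) (hlam2 : lam ≤ 1 / 2)
    {Ω : Type*} [MeasurableSpace Ω] (μ : Measure Ω) [IsProbabilityMeasure μ]
    (ζ : ℕ → Ω → Fin N) (hζ : SMSPDFP.BlockSelection μ ζ)
    (u₀ : SMSPDFP.State X N) :
    ∀ᵐ ω ∂μ, ∃ xs : X,
      SMSPDFP.IsMinimizer (SMSPDFP.liftedObjective f g) (fun _ => xs) ∧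
      Tendsto
        (fun k => SMSPDFP.avg (SMSPDFP.iterates f g γ lam (fun j => ζ j ω) u₀ k).x)
        atTop (𝓝 xs) := by
  have hN0 : N ≠ 0 := by omega
  filter_upwards [hfg.ae_exists_tendsto_blockIterates hN0 hγ hγβ hlam hlam2 hζ u₀.toBlocks]
    with ω ⟨z, hz, hlim⟩
  obtain ⟨xs, hxs, hmin⟩ := hfg.exists_isMinimizer_of_fullStep_eq hN0 hγ hlam hz
  refine ⟨xs, hmin, ?_⟩
  have hc : Continuous fun u : Fin N → X × X × X => SMSPDFP.avg fun n => (u n).2.2 := by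
    unfold SMSPDFP.avg
    fun_prop
  have h1 := (hc.tendsto z).comp hlim
  simp only [hxs, SMSPDFP.avg_const hN0] at h1
  refine h1.congr fun k => ?_
  rw [Function.comp_apply, ← SMSPDFP.toBlocks_iterates]
  rfl
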